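/- Let $X$ and $Y$ be $\sigma$-compact metric spaces with their Borel $\sigma$-algebras, equipped with $\sigma$-finite diffuse measures $\sigma$ on $X$ and $\mu$ on $Y$ that are finite on compact sets. Let $\Omega^X$ be the space of locally finite subsets (configurations) $\omega$ of $X$, identified with the point measures $\omega=\sum_{x\in\omega}\epsilon_x$ and equipped with the $\sigma$-algebra generated by the maps $\omega\mapsto\omega(A)$, $A$ Borel. Let $\pi_\sigma$ be the Poisson measure on $\Omega^X$ with intensity $\sigma$, i.e. the probability measure under which, for all disjoint compact sets $A_1,\dots,A_n$, the variables $\omega(A_1),\dots,\omega(A_n)$ are independent and Poisson distributed with means $\sigma(A_1),\dots,\sigma(A_n)$; write $E_\sigma$ for its expectation, and define $\Omega^Y$ and $\pi_\mu$ in the same way. For $F:\Omega^X\to\mathbb R$ put $D_xF(\omega)=F(\omega\cup\{x\})-F(\omega)$, and $D_\Theta=\prod_{x\in\Theta}D_x$ for a finite set $\Theta\subset X$. For random variables $F_0,\dots,F_a$ and points $s_0,\dots,s_a\in X$ put $$\Delta_{s_0}\cdots\Delta_{s_a}\Big(\prod_{p=0}^aF_p\Big)=\sum_{\substack{\Theta_0\cup\cdots\cup\Theta_a=\{s_0,\dots,s_a\}\\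 s_0\notin\Theta_0,\dots,s_a\notin\Theta_a}}D_{\Theta_0}F_0\cdots D_{\Theta_a}F_a .$$ For a measurable process $u:\Omega^X\times X\to\mathbb R$ with $E_\sigma[\int_X|u_t|\,\sigma(dt)]<\infty$ the Skorohod integral is $$\delta_\sigma(u)(\omega)=\int_Xu_t(\omega\setminus\{t\})\,(\omega(dt)-\sigma(dt)),$$ and $\delta_\mu$ is defined in the same way on $\Omega^Y$; for a deterministic $h\in L^1_\mu(Y)$, $\delta_\mu(h)=\int_Yh\,d(\omega-\mu)$ is the compensated Poisson integral. Let $R$ be a random isometry $L^p_\mu(Y)\to L^p_\sigma(X)$ for all $p\in[1,\infty]$, that is, for every $\omega\in\Omega^X$, $R(\omega)$ is a map which for each $p\in[1,\infty]$ restricts to a linear, norm preserving and positivity preserving ($f\ge0\Rightarrow R(\omega)f\ge0$) map from $L^p_\mu(Y)$ to $L^p_\sigma(X)$. (Example: $R(\omega)f=f\circ\tau(\omega,\cdot)$, where $\tau(\omega,\cdot):X\to Y$ maps $\sigma$ to $\mu$.) Let $h\in\bigcap_{1\le p<\infty}L^p_\mu(Y)$ with $\sup_{p\ge1}\|h\|_{L^p_\mu(Y)}<\infty$,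 and let $Rh:\Omega^X\times X\to\mathbb R$ be a measurable process with $Rh(\omega,\cdot)=R(\omega)h$ $\sigma$-a.e., for $\pi_\sigma$-a.e. $\omega$. Assume that $$E_\sigma\Big[\int_{X^{a+1}}\Big|\Delta_{s_0}\cdots\Delta_{s_a}\Big(\prod_{p=0}^a(Rh(s_p))^{l_p}\Big)\Big|\,\sigma(ds_0)\cdots\sigma(ds_a)\Big]<\infty$$ for all $a\ge0$ and all integers $l_0,\dots,l_a\ge1$, and that for all $k\ge2$ $$D_{t_1}Rh(t_2)\,D_{t_2}Rh(t_3)\cdots D_{t_{k-1}}Rh(t_k)\,D_{t_k}Rh(t_1)=0\qquad \pi_\sigma\otimes\sigma^{\otimes k}\text{-a.e.}$$ Then $E_\sigma[\int_X|Rh(t)|\,\sigma(dt)]<\infty$, and $\delta_\sigma(Rh)$ has the same distribution under $\pi_\sigma$ as the compensated Poisson integral $\delta_\mu(h)$ under $\pi_\mu$. -/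

import Mathlib

open MeasureTheory ProbabilityTheory
open scoped ENNReal NNReal

noncomputable section

namespace PoissonInvariance

/-- The configuration space over `X`: the locally finite subsets of `X`. In a metric space, local
finiteness at every point is the same as finiteness on every compact set; when `X` is
`σ`-compact such a set is automatically at most countable. -/
def Configuration (X : Type*) [TopologicalSpace X] : Type _ :=
  {ω : Set X // ∀ K : Set X, IsCompact K → (ω ∩ K).Finite}

namespace Configuration

variable {X : Type*} [TopologicalSpace X]

/-- The set of points of a configuration. -/
def points (ω : Configuration X) : Set X := ω.1

/-- `ω ∪ {x}`. -/
def insert (x : X) (ω : Configuration X) : Configuration X :=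
  ⟨ω.points ∪ {x}, fun K hK => by
    rw [Set.union_inter_distrib_right]
    exact (ω.2 K hK).union ((Set.finite_singleton x).inter_of_left K)⟩

/-- `ω \ {x}`. -/
def erase (x : X) (ω : Configuration X) : Configuration X :=
  ⟨ω.points \ {x}, fun K hK =>
    (ω.2 K hK).subset (Set.inter_subset_inter_left K Set.sdiff_subset)⟩

/-- The number of points of `ω` in `A` (used for compact `A`, where it is finite). -/
def count (A : Set X) (ω : Configuration X) : ℕ := (ω.points ∩ A).ncard

/-- The point measure `∑_{x ∈ ω} ε_x`. -/
def toMeasure [MeasurableSpace X] (ω : Configuration X) : Measure X :=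
  Measure.sum fun x : ω.points => Measure.dirac (x : X)

/-- The σ-algebra generated by the evaluations `ω ↦ ω(A)`, `A` measurable. -/
instance [MeasurableSpace X] : MeasurableSpace (Configuration X) :=
  MeasurableSpace.comap toMeasure inferInstance

end Configuration

section Poisson

variable {X : Type*} [TopologicalSpace X] [MeasurableSpace X]

/-- `P` is the Poisson measure `π_σ` with intensity `σ`: it is a probability measure under which
the numbers of points in disjoint compact sets `A₁, …, Aₙ` are independent Poisson variables
with intensities `σ(A₁), …, σ(Aₙ)` (`σ` is finite on compact sets wherever this is used). -/
structure IsPoissonMeasure (σ : Measure X) (P : Measure (Configuration X)) : Prop where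
  isProbabilityMeasure : IsProbabilityMeasure P
  map_count : ∀ A : Set X, IsCompact A →
    P.map (Configuration.count A) = poissonMeasure (σ A).toNNReal
  iIndepFun_count : ∀ (n : ℕ) (A : Fin n → Set X), (∀ i, IsCompact (A i)) →
    Pairwise (fun i j => Disjoint (A i) (A j)) →
    iIndepFun (fun i => Configuration.count (A i)) P

/-- The Skorohod integral
`δ_σ(u)(ω) = ∫ u_t(ω \ {t}) (ω(dt) - σ(dt))` of a process `u`. -/
def skorohod (σ : Measure X) (u : Configuration X → X → ℝ) (ω : Configuration X) : ℝ :=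
  (∫ t, u (ω.erase t) t ∂ω.toMeasure) - ∫ t, u (ω.erase t) t ∂σ

/-- The process `u` lies in the domain of the Skorohod integral:
`E_σ[∫ |u(ω, t)| σ(dt)] < ∞`. -/
def InSkorohodDomain (σ : Measure X) (P : Measure (Configuration X))
    (u : Configuration X → X → ℝ) : Prop :=
  Measurable (Function.uncurry u) ∧ ∫⁻ ω, ∫⁻ t, ‖u ω t‖ₑ ∂σ ∂P < ∞

end Poisson

section Difference

variable {X : Type*} [TopologicalSpace X]

/-- The finite difference gradient `D_x F(ω) = F(ω ∪ {x}) - F(ω)`. -/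
def diff (x : X) (F : Configuration X → ℝ) (ω : Configuration X) : ℝ :=
  F (ω.insert x) - F ω

/-- `D_Θ F = (∏_{i ∈ Θ} D_{s i}) F`, the composition of the operators `D_{s i}`, `i ∈ Θ`
(they commute, so the order is immaterial). -/
def diffSet {n : ℕ} (s : Fin n → X) (Θ : Finset (Fin n)) (F : Configuration X → ℝ) :
    Configuration X → ℝ :=
  (Θ.sort (· ≤ ·)).foldr (fun i G => diff (s i) G) F

/-- `Δ_{s_0} ⋯ Δ_{s_j} (∏_{p=0}^n F_p)`, where `F_p` is the random variable attached to `s_p`: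
the sum of `∏_{p=0}^n D_{Θ_p} F_p` over all `Θ_0, …, Θ_n` with union `{s_0, …, s_j}` such that
`s_i ∉ Θ_i` for `i = 0, …, j`. Subsets of `{s_0, …, s_j}` are represented by sets of indices. -/
def bigDelta {n : ℕ} (j : Fin (n + 1)) (s : Fin (n + 1) → X)
    (F : Fin (n + 1) → Configuration X → ℝ) (ω : Configuration X) : ℝ :=
  ∑ Θ : Fin (n + 1) → Finset (Fin (n + 1)) with
      (Finset.univ.biUnion Θ = Finset.Iic j ∧ ∀ i ≤ j, i ∉ Θ i),
    ∏ p, diffSet s (Θ p) (F p) ω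

variable [MeasurableSpace X]

/-- The integrability bound: for all `a ≥ 0` and `l_0, …, l_a ≥ 1`,
`E_σ[∫_{X^{a+1}} |Δ_{s_0} ⋯ Δ_{s_a} (∏_{p=0}^a u_{s_p}^{l_p})| σ(ds_0) ⋯ σ(ds_a)] < ∞`. -/
def DeltaBound (σ : Measure X) (P : Measure (Configuration X))
    (u : Configuration X → X → ℝ) : Prop :=
  ∀ (a : ℕ) (l : Fin (a + 1) → ℕ), (∀ p, 1 ≤ l p) →
    ∫⁻ ω, ∫⁻ s : Fin (a + 1) → X,
      ‖bigDelta (Fin.last a) s (fun p ω' => u ω' (s p) ^ l p) ω‖ₑ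
        ∂(Measure.pi fun _ => σ) ∂P < ∞

/-- The cyclic condition `D_{t_1} u_{t_2} ⋯ D_{t_{k-1}} u_{t_k} D_{t_k} u_{t_1} = 0`,
`π_σ ⊗ σ^{⊗k}`-almost everywhere, for all `k = m + 2 ≥ 2`; the sum `i + 1` in `Fin (m + 2)`
wraps around. -/
def CyclicCondition (σ : Measure X) (P : Measure (Configuration X))
    (u : Configuration X → X → ℝ) : Prop :=
  ∀ m : ℕ, ∀ᵐ q ∂(P.prod (Measure.pi fun _ : Fin (m + 2) => σ)),
    ∏ i : Fin (m + 2), diff (q.2 i) (fun ω => u ω (q.2 (i + 1))) q.1 = 0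

end Difference

/-- `R` is a random isometry from `L^p_μ(Y)` to `L^p_σ(X)` for all `p ∈ [1, ∞]`: for every
configuration `ω`, `R(ω)` is a linear and norm preserving map from `L^p_μ(Y)` to `L^p_σ(X)` for
every `p ∈ [1, ∞]` (its values outside the `L^p` spaces are irrelevant). As for the isometries
`h ↦ h ∘ τ(ω, ·)` given by maps `τ(ω, ·)` that send `σ` to `μ`, it is part of the notion that
`R(ω)` sends nonnegative functions to nonnegative functions. -/
structure IsRandomIsometry {X Y : Type*} [TopologicalSpace X] [MeasurableSpace X]
    [MeasurableSpace Y] (σ : Measure X) (μ : Measure Y)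
    (R : Configuration X → (Y →ₘ[μ] ℝ) → (X →ₘ[σ] ℝ)) : Prop where
  map_add : ∀ (ω : Configuration X) (p : ℝ≥0∞), 1 ≤ p → ∀ f ∈ Lp ℝ p μ, ∀ g ∈ Lp ℝ p μ,
    R ω (f + g) = R ω f + R ω g
  map_smul : ∀ (ω : Configuration X) (p : ℝ≥0∞), 1 ≤ p → ∀ (c : ℝ), ∀ f ∈ Lp ℝ p μ,
    R ω (c • f) = c • R ω f
  eLpNorm_map : ∀ (ω : Configuration X) (p : ℝ≥0∞), 1 ≤ p → ∀ f ∈ Lp ℝ p μ,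
    eLpNorm (R ω f) p σ = eLpNorm f p μ
  nonneg : ∀ (ω : Configuration X) (p : ℝ≥0∞), 1 ≤ p → ∀ f ∈ Lp ℝ p μ,
    0 ≤ f → 0 ≤ R ω f

end PoissonInvariance

end

set_option linter.unusedSectionVars false

/-! Write u for the process Rh. For almost every ω the nonzero values of u(ω, ·) have the same
distribution ν under σ, namely that of the nonzero values of h under μ. Indeed the L^p norms for all
p ≥ 1 determine the law of a nonnegative function on (0, ∞), and a positivity preserving L¹ isometry
sends the positive and negative parts of h to functions with disjoint supports
(`IsRandomIsometry.measure_preimage_eq`).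

Up to a constant, the Skorohod integral is the sum over t in ω of the values u_t(ω \ {t}). The core
of the proof is that, away from 0, these values have the factorial moment measures ν^{⊗n} of a
Poisson process with intensity ν (`measure_boxEvent_univ`). By the Mecke formula, the n-th one is
governed by independent extra points s_1, …, s_n and the values u_{s_p}(ω ∪ {s_i : i ≠ p}). Compare
this with the variants in which only the s_i with i in a subset S are switched on. For proper S, the
points outside S are fresh for the configuration ω ∪ s_S, so they contribute independent factors
ν(B_p), and induction on n handles the points of S. For the full set, the cyclic condition says that
the dependence of the values on the switches has no circuit. A combinatorial fact about such Boolean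
networks (`IsAcyclicNetwork.card_even_eq_card_odd`) shows that, pointwise, as many even as odd S put
all values into the prescribed sets. Taking expectations, the one unknown term must equal the common
value of all the others.

Summing the factorial moments against e^φ - 1 gives the exponential formula `lintegral_exp_pointSum`
for φ ≥ 0. It yields the joint exponential moments, with nonnegative coefficients, of the sums of
positive and of negative parts; analytic continuation in one coefficient at a time then identifies
the law of their difference. The deterministic integrand h is an instance of the same situation with
the same ν, which gives the equality in law. -/

namespace PoissonInvariance

/-! ### Acyclic Boolean networks -/

section Combinatorics

variable {ι : Type*}

/-- A self-map of a finite set without fixed points has a cycle of length at least two. -/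
theorem exists_cycle_of_forall_ne {K : Finset ι} (hK : K.Nonempty) (f : ι → ι)
    (hmaps : ∀ i ∈ K, f i ∈ K) (hne : ∀ i ∈ K, f i ≠ i) :
    ∃ (m : ℕ) (e : Fin (m + 2) → ι), Function.Injective e ∧ (∀ j, e j ∈ K) ∧
      ∀ j, e (j + 1) = f (e j) := by
  classical
  obtain ⟨x₀, hx₀⟩ := hK
  have hiter : ∀ x ∈ K, ∀ n, f^[n] x ∈ K := by
    intro x hx n
    induction n with
    | zero => exact hx
    | succ n ih => rw [Function.iterate_succ_apply']; exact hmaps _ ih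
  have hex : ∃ x ∈ K, x ∈ Function.periodicPts f := by
    have hni : ¬ Function.Injective (fun n : ℕ => (⟨f^[n] x₀, hiter _ hx₀ n⟩ : K)) := by
      exact not_injective_infinite_finite _
    simp only [Function.Injective, not_forall] at hni
    obtain ⟨a, b, hab, hne'⟩ := hni
    have hab' : f^[a] x₀ = f^[b] x₀ := congrArg Subtype.val hab
    wlog hlt : a < b generalizing a b
    · exact this b a hab.symm (Ne.symm hne') hab'.symm (by omega)
    refine ⟨f^[a] x₀, hiter _ hx₀ a, Function.mk_mem_periodicPts (n := b - a) (by omega) ?_⟩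
    change f^[b - a] (f^[a] x₀) = f^[a] x₀
    rw [← Function.iterate_add_apply, Nat.sub_add_cancel hlt.le, hab']
  obtain ⟨x, hxK, hx⟩ := hex
  have hpos : 0 < Function.minimalPeriod f x := Function.minimalPeriod_pos_of_mem_periodicPts hx
  have hone : Function.minimalPeriod f x ≠ 1 := fun h =>
    hne x hxK (Function.minimalPeriod_eq_one_iff_isFixedPt.1 h)
  obtain ⟨m, hm⟩ : ∃ m, Function.minimalPeriod f x = m + 2 :=
    ⟨Function.minimalPeriod f x - 2, by omega⟩
  refine ⟨m, fun j => f^[j] x, ?_, fun j => hiter x hxK _, ?_⟩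
  · intro a b hab
    have := Function.iterate_injOn_Iio_minimalPeriod (f := f) (x := x)
      (by rw [hm]; exact a.2) (by rw [hm]; exact b.2) hab
    exact Fin.ext this
  · intro j
    change f^[((j + 1 : Fin (m + 2)) : ℕ)] x = f (f^[j] x)
    rw [← Function.iterate_succ_apply' f, ← Function.iterate_mod_minimalPeriod_eq (n := j.val.succ),
      hm, Fin.val_add]
    simp

variable [DecidableEq ι]

/-- `f` is a Boolean network: `f p S` is the value at `p` when the coordinates in `S` are switched
on. It has no self-dependence, and no dependence circuit at any `S` through coordinates that are
switched off. -/
structure IsAcyclicNetwork (f : ι → Finset ι → Bool) : Prop where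
  self : ∀ p S, f p (insert p S) = f p S
  circuit : ∀ (S : Finset ι) (m : ℕ) (e : Fin (m + 2) → ι), Function.Injective e →
    (∀ j, e j ∉ S) → ∃ j, f (e (j + 1)) (insert (e j) S) = f (e (j + 1)) S

/-- Otherwise each i in K changes the value at some g i in K. There is no self-dependence, so g has
no fixed point, and a cycle of g is a forbidden dependence circuit at A. -/
theorem IsAcyclicNetwork.exists_sink {f : ι → Finset ι → Bool} (hf : IsAcyclicNetwork f)
    {K A : Finset ι} (hK : K.Nonempty) (hKA : Disjoint K A) :
    ∃ i ∈ K, ∀ p ∈ K, f p (insert i A) = f p A := by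
  by_contra! hcon
  choose! g hg using hcon
  obtain ⟨m, e, hinj, heK, he⟩ := exists_cycle_of_forall_ne hK g (fun i hi => (hg i hi).1) (by
    intro i hi h
    have := (hg i hi).2
    rw [h] at this
    exact this (hf.self i A))
  obtain ⟨j, hj⟩ := hf.circuit A m e hinj (fun j => Finset.disjoint_left.1 hKA (heK j))
  rw [he] at hj
  exact (hg _ (heK j)).2 hj

/-- The `0`-`1` value of a Boolean. -/
def boolInt (b : Bool) : ℤ := if b then 1 else 0

/-- The alternating sum over a face of the cube splits along a subset of the coordinates. -/
theorem sum_powerset_eq_sum_sum_powerset {M : Type*} [AddCommMonoid M] {U K : Finset ι}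
    (hUK : U ⊆ K) (F : Finset ι → M) :
    ∑ S ∈ K.powerset, F S = ∑ T ∈ (K \ U).powerset, ∑ S ∈ U.powerset, F (T ∪ S) := by
  rw [← Finset.sum_product']
  symm
  refine Finset.sum_bij' (fun x _ => x.1 ∪ x.2) (fun S _ => (S \ U, S ∩ U)) ?_ ?_ ?_ ?_ ?_
  · rintro ⟨T, S⟩ h
    simp only [Finset.mem_product, Finset.mem_powerset] at h ⊢
    exact Finset.union_subset (h.1.trans Finset.sdiff_subset) (h.2.trans hUK)
  · intro S h
    simp only [Finset.mem_product, Finset.mem_powerset] at h ⊢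
    exact ⟨Finset.sdiff_subset_sdiff h le_rfl, Finset.inter_subset_right⟩
  · rintro ⟨T, S⟩ h
    simp only [Finset.mem_product, Finset.mem_powerset] at h
    have h1 : ∀ x ∈ T, x ∉ U := fun x hx => (Finset.mem_sdiff.1 (h.1 hx)).2
    have h2 : ∀ x ∈ S, x ∈ U := fun x hx => h.2 hx
    ext x <;> simp <;> grind
  · intro S h
    simp only
    ext x; simp; grind
  · rintro ⟨T, S⟩ h
    rfl

/-- The base set A of switched-on coordinates is kept general because the induction on K moves
coordinates from K into it. -/
theorem IsAcyclicNetwork.sum_neg_one_pow_card_mul_prod {f : ι → Finset ι → Bool}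
    (hf : IsAcyclicNetwork f) (K : Finset ι) :
    ∀ A : Finset ι, K.Nonempty → Disjoint K A →
      ∑ S ∈ K.powerset, (-1 : ℤ) ^ S.card * ∏ p ∈ K, boolInt (f p (A ∪ S)) = 0 := by
  induction K using Finset.strongInduction with
  | H K ih =>
  intro A hK hKA
  obtain ⟨i, hiK, hi⟩ := hf.exists_sink hK hKA
  -- By the choice of the sink i, the sets ∅ and {i} give the same vector of values. The map from
  -- subsets of K to Boolean vectors on K is thus not injective, hence not surjective, both sides
  -- having 2^|K| elements; b is a vector that is missed.
  obtain ⟨b, hb⟩ : ∃ b : K → Bool, ∀ S ∈ K.powerset, ∃ p : K, f p (A ∪ S) ≠ b p := by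
    by_contra! hcon
    let Φ : K.powerset → (K → Bool) := fun S p => f p (A ∪ S)
    have hsurj : Function.Surjective Φ := fun b => by
      obtain ⟨S, hS, h⟩ := hcon b
      exact ⟨⟨S, hS⟩, funext h⟩
    have hinj : Function.Injective Φ := by
      refine ((Fintype.bijective_iff_surjective_and_card Φ).2 ⟨hsurj, ?_⟩).1
      simp
    have h1 : Φ ⟨∅, by simp⟩ = Φ ⟨{i}, by simpa using hiK⟩ := by
      funext p
      simp only [Φ, Finset.union_empty]
      rw [Finset.union_comm, ← Finset.insert_eq, hi p p.2]
    have := congrArg Subtype.val (hinj h1)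
    simp at this
  -- Differing from b at p means agreeing with its negation c there, so the product of the
  -- differences from c vanishes for every S. Expanding it leaves the wanted sum as the term U = K.
  set c : ι → ℤ := fun p => if h : p ∈ K then boolInt (!(b ⟨p, h⟩)) else 0 with hc
  have hzero : ∀ S ∈ K.powerset, ∏ p ∈ K, (boolInt (f p (A ∪ S)) + - c p) = 0 := by
    intro S hS
    obtain ⟨p, hp⟩ := hb S hS
    refine Finset.prod_eq_zero p.2 ?_
    have : f p (A ∪ S) = !(b p) := by
      revert hp; cases f p (A ∪ S) <;> cases b p <;> simp
    simp [hc, this]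
  have hsum : ∑ S ∈ K.powerset, (-1 : ℤ) ^ S.card *
      ∏ p ∈ K, (boolInt (f p (A ∪ S)) + - c p) = 0 :=
    Finset.sum_eq_zero fun S hS => by rw [hzero S hS, mul_zero]
  simp_rw [Finset.prod_add, Finset.mul_sum] at hsum
  rw [Finset.sum_comm] at hsum
  rw [Finset.sum_eq_single K] at hsum
  · simpa using hsum
  · intro U hU hUK
    have hU' : U ⊂ K := lt_of_le_of_ne (Finset.mem_powerset.1 hU) hUK
    -- For nonempty proper U, fix the part T of S outside U and apply the induction hypothesis to U
    -- over the base A ∪ T.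
    have : ∑ S ∈ K.powerset, (-1 : ℤ) ^ S.card * ∏ p ∈ U, boolInt (f p (A ∪ S)) = 0 := by
      rcases U.eq_empty_or_nonempty with rfl | hUne
      · simpa using Finset.sum_powerset_neg_one_pow_card_of_nonempty hK
      · rw [sum_powerset_eq_sum_sum_powerset hU'.1]
        refine Finset.sum_eq_zero fun T hT => ?_
        have hT' := Finset.mem_powerset.1 hT
        have hd : Disjoint T U := Finset.disjoint_left.2 fun x hx =>
          (Finset.mem_sdiff.1 (hT' hx)).2
        have h2 := ih U hU' (A ∪ T) hUne (by
          rw [Finset.disjoint_union_right]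
          exact ⟨hKA.mono_left hU'.1, hd.symm⟩)
        rw [← mul_zero ((-1 : ℤ) ^ T.card), ← h2, Finset.mul_sum]
        refine Finset.sum_congr rfl fun S hS => ?_
        rw [Finset.card_union_of_disjoint (hd.mono_right (Finset.mem_powerset.1 hS)), pow_add,
          mul_assoc, Finset.union_assoc]
    calc _ = (∑ S ∈ K.powerset, (-1 : ℤ) ^ S.card * ∏ p ∈ U, boolInt (f p (A ∪ S))) *
          ∏ p ∈ K \ U, - c p := by
          rw [Finset.sum_mul]; exact Finset.sum_congr rfl fun S _ => by ring
      _ = 0 := by rw [this, zero_mul]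
  · intro h; simp at h

/-- In an acyclic network with at least one coordinate, the sets `S` at which all values are `true`
are as often even as odd. -/
theorem IsAcyclicNetwork.card_even_eq_card_odd [Fintype ι] [Nonempty ι]
    {f : ι → Finset ι → Bool} (hf : IsAcyclicNetwork f) :
    (Finset.univ.filter fun S : Finset ι => Even S.card ∧ ∀ p, f p S = true).card =
      (Finset.univ.filter fun S : Finset ι => ¬ Even S.card ∧ ∀ p, f p S = true).card := by
  have h := hf.sum_neg_one_pow_card_mul_prod Finset.univ ∅ Finset.univ_nonempty (by simp)
  have key : ∀ S : Finset ι, (-1 : ℤ) ^ S.card * ∏ p ∈ Finset.univ, boolInt (f p (∅ ∪ S)) =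
      (if Even S.card ∧ ∀ p, f p S = true then 1 else 0) -
        (if ¬ Even S.card ∧ ∀ p, f p S = true then 1 else 0) := by
    intro S
    rw [Finset.empty_union]
    by_cases hall : ∀ p, f p S = true
    · by_cases hev : Even S.card
      · simp [hall, hev, boolInt]
      · simp [hall, hev, boolInt, Nat.not_even_iff_odd.1 hev]
    · have : ∏ p ∈ Finset.univ, boolInt (f p S) = 0 := by
        push Not at hall
        obtain ⟨p, hp⟩ := hall
        exact Finset.prod_eq_zero (Finset.mem_univ p) (by simp [boolInt, hp])
      simp [hall, this]
  simp_rw [key, Finset.powerset_univ, Finset.sum_sub_distrib, Finset.sum_boole] at h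
  exact_mod_cast sub_eq_zero.1 h

end Combinatorics

end PoissonInvariance

/-! ### Measurability on the configuration space -/

namespace PoissonInvariance

section KernelSFinite

/-- A kernel all of whose values are finite measures is s-finite. -/
theorem isSFiniteKernel_of_forall_isFiniteMeasure {α β : Type*} {mα : MeasurableSpace α}
    {mβ : MeasurableSpace β} (κ : Kernel α β) (hκ : ∀ a, IsFiniteMeasure (κ a)) :
    IsSFiniteKernel κ := by
  have hmeas : Measurable fun a => ⌊(κ a Set.univ).toReal⌋₊ :=
    Nat.measurable_floor.comp (κ.measurable_coe MeasurableSet.univ).ennreal_toReal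
  have hs : ∀ n : ℕ, MeasurableSet {a | ⌊(κ a Set.univ).toReal⌋₊ = n} := fun n =>
    hmeas (measurableSet_singleton n)
  classical
  -- Slice the parameter space by the integer part n of the total mass; on a slice the mass is
  -- bounded by n + 1.
  have hsum : κ = Kernel.sum fun n : ℕ => Kernel.piecewise (hs n) κ 0 := by
    ext a s hs'
    rw [Kernel.sum_apply' _ _ hs', tsum_eq_single ⌊(κ a Set.univ).toReal⌋₊]
    · simp [Kernel.piecewise_apply]
    · intro n hn
      simp [Kernel.piecewise_apply, hn.symm]
  rw [hsum]
  have : ∀ n : ℕ, IsFiniteKernel (Kernel.piecewise (hs n) κ 0) := by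
    intro n
    refine ⟨⟨(n + 1 : ℕ), by simp, fun a => ?_⟩⟩
    rw [Kernel.piecewise_apply]
    split_ifs with h
    · have h1 : (κ a Set.univ).toReal < n + 1 := by
        have := Nat.lt_floor_add_one (κ a Set.univ).toReal
        rw [show ⌊(κ a Set.univ).toReal⌋₊ = n from h] at this
        exact this
      have h2 := measure_ne_top (κ a) Set.univ
      rw [← ENNReal.ofReal_toReal h2]
      refine (ENNReal.ofReal_le_ofReal h1.le).trans (le_of_eq ?_)
      rw [show ((n : ℝ) + 1) = ((n + 1 : ℕ) : ℝ) by push_cast; ring, ENNReal.ofReal_natCast]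
    · simp
  infer_instance

end KernelSFinite

namespace Configuration

variable {X : Type*}

@[ext]
theorem ext_points [TopologicalSpace X] {ω ω' : Configuration X} (h : ω.points = ω'.points) :
    ω = ω' :=
  Subtype.ext h

@[simp]
theorem points_insert [TopologicalSpace X] (x : X) (ω : Configuration X) :
    (ω.insert x).points = Insert.insert x ω.points := by
  change ω.points ∪ {x} = _
  rw [Set.union_singleton]

@[simp]
theorem points_erase [TopologicalSpace X] (x : X) (ω : Configuration X) :
    (ω.erase x).points = ω.points \ {x} := rfl

theorem insert_erase [TopologicalSpace X] {x : X} {ω : Configuration X} (hx : x ∈ ω.points) :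
    (ω.erase x).insert x = ω := by
  ext1; simp [hx]

theorem erase_eq_self [TopologicalSpace X] {x : X} {ω : Configuration X} (hx : x ∉ ω.points) :
    ω.erase x = ω := by
  ext1; simp [hx]

theorem countable_points [TopologicalSpace X] [SigmaCompactSpace X] (ω : Configuration X) :
    ω.points.Countable := by
  have : ω.points = ⋃ n, ω.points ∩ compactCovering X n := by
    rw [← Set.inter_iUnion, iUnion_compactCovering, Set.inter_univ]
  rw [this]
  exact Set.countable_iUnion fun n => (ω.2 _ (isCompact_compactCovering X n)).countable

theorem toMeasure_apply [TopologicalSpace X] [MeasurableSpace X]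
    (ω : Configuration X) {A : Set X} (hA : MeasurableSet A) :
    ω.toMeasure A = ((ω.points ∩ A).encard : ℝ≥0∞) := by
  rw [toMeasure, Measure.sum_apply _ hA]
  simp_rw [Measure.dirac_apply' _ hA]
  rw [← ENNReal.tsum_set_one, tsum_subtype, tsum_subtype (ω.points ∩ A) (fun _ => (1 : ℝ≥0∞)),
    ← Set.indicator_indicator]
  rfl

theorem toMeasure_eq_count [TopologicalSpace X] [MeasurableSpace X]
    (ω : Configuration X) {A K : Set X} (hA : MeasurableSet A) (hK : IsCompact K) (hAK : A ⊆ K) :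
    ω.toMeasure A = (count A ω : ℝ≥0∞) := by
  have hfin : (ω.points ∩ A).Finite :=
    (ω.2 K hK).subset (Set.inter_subset_inter_right _ hAK)
  rw [toMeasure_apply ω hA, count, ← hfin.cast_ncard_eq]
  simp

theorem lintegral_toMeasure [TopologicalSpace X] [MeasurableSpace X] [MeasurableSingletonClass X]
    (ω : Configuration X) (f : X → ℝ≥0∞) :
    ∫⁻ t, f t ∂ω.toMeasure = ∑' t : ω.points, f t := by
  simp [toMeasure, lintegral_sum_measure]

theorem ae_toMeasure_iff [TopologicalSpace X] [MeasurableSpace X] [MeasurableSingletonClass X]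
    [SigmaCompactSpace X] {ω : Configuration X} {p : X → Prop} :
    (∀ᵐ t ∂ω.toMeasure, p t) ↔ ∀ t ∈ ω.points, p t := by
  have := ω.countable_points.to_subtype
  simp [toMeasure, ae_dirac_eq]

theorem measurable_toMeasure [TopologicalSpace X] [MeasurableSpace X] :
    Measurable (toMeasure : Configuration X → Measure X) :=
  comap_measurable _

/-- The kernel `ω ↦ ∑_{x ∈ ω} ε_x`. -/
noncomputable def pointKernel (X : Type*) [TopologicalSpace X] [MeasurableSpace X] :
    Kernel (Configuration X) X :=
  ⟨toMeasure, measurable_toMeasure⟩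

@[simp]
theorem pointKernel_apply [TopologicalSpace X] [MeasurableSpace X] (ω : Configuration X) :
    pointKernel X ω = ω.toMeasure := rfl

theorem measurable_of_toMeasure {α : Type*} [MeasurableSpace α] [TopologicalSpace X]
    [MeasurableSpace X] {f : α → Configuration X}
    (h : ∀ A, MeasurableSet A → Measurable fun a => (f a).toMeasure A) : Measurable f :=
  measurable_comap_iff.2 (Measure.measurable_of_measurable_coe _ h)

theorem measurable_toMeasure_apply [TopologicalSpace X] [MeasurableSpace X] {A : Set X} (hA : MeasurableSet A) :
    Measurable fun ω : Configuration X => ω.toMeasure A :=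
  (Measure.measurable_coe hA).comp measurable_toMeasure

theorem measurable_count [TopologicalSpace X] [MeasurableSpace X] {A K : Set X} (hA : MeasurableSet A)
    (hK : IsCompact K) (hAK : A ⊆ K) :
    Measurable (count A : Configuration X → ℕ) := by
  have : (fun ω : Configuration X => (count A ω : ℝ≥0∞)) = fun ω => ω.toMeasure A :=
    funext fun ω => (toMeasure_eq_count ω hA hK hAK).symm
  have h := measurable_toMeasure_apply hA
  rw [← this] at h
  refine measurable_to_countable' fun n => ?_
  have : count A ⁻¹' {n} = (fun ω : Configuration X => (count A ω : ℝ≥0∞)) ⁻¹' {(n : ℝ≥0∞)} := by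
    ext ω; simp
  rw [this]
  exact h (measurableSet_singleton _)

section Metric

variable [MetricSpace X] [SigmaCompactSpace X] [MeasurableSpace X] [BorelSpace X]

theorem measurableSet_compactCovering (n : ℕ) : MeasurableSet (compactCovering X n) :=
  (isCompact_compactCovering X n).measurableSet

/-- A configuration has finitely many points in each piece of a partition of X by subsets of compact
sets. S-finiteness is what makes integrals against ω measurable in ω. -/
instance : IsSFiniteKernel (pointKernel X) := by
  have hD : ∀ n, MeasurableSet (disjointed (compactCovering X) n) :=
    fun n => MeasurableSet.disjointed measurableSet_compactCovering n
  have hsum : pointKernel X = Kernel.sum fun n => (pointKernel X).restrict (hD n) := by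
    ext ω s hs
    rw [Kernel.sum_apply' _ _ hs]
    simp_rw [Kernel.restrict_apply]
    rw [← Measure.sum_apply _ hs, ← Measure.restrict_iUnion (disjoint_disjointed _) hD,
      iUnion_disjointed, iUnion_compactCovering, Measure.restrict_univ]
  rw [hsum]
  have : ∀ n, IsSFiniteKernel ((pointKernel X).restrict (hD n)) := by
    intro n
    refine isSFiniteKernel_of_forall_isFiniteMeasure _ fun ω => ⟨?_⟩
    rw [Kernel.restrict_apply, Measure.restrict_apply_univ, pointKernel_apply,
      toMeasure_eq_count ω (hD n) (isCompact_compactCovering X n) (disjointed_subset _ n)]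
    exact ENNReal.natCast_lt_top _
  infer_instance

theorem measurable_lintegral_toMeasure {α : Type*} [MeasurableSpace α] {f : α → Configuration X}
    (hf : Measurable f) {G : α → X → ℝ≥0∞} (hG : Measurable (Function.uncurry G)) :
    Measurable fun a => ∫⁻ t, G a t ∂(f a).toMeasure := by
  exact Measurable.lintegral_kernel_prod_right (κ := (pointKernel X).comap f hf) hG

theorem toMeasure_erase_apply (ω : Configuration X) (t : X) {A : Set X} (hA : MeasurableSet A) :
    (ω.erase t).toMeasure A = ω.toMeasure (A \ {t}) := by
  rw [toMeasure_apply _ hA, toMeasure_apply _ (hA.diff (measurableSet_singleton t)), points_erase]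
  congr 2
  ext; simp; tauto

/-- The point t is removed from A first because it may already belong to ω, and configurations have
no multiplicities. -/
theorem toMeasure_insert_apply (ω : Configuration X) (t : X) {A : Set X} (hA : MeasurableSet A) :
    (ω.insert t).toMeasure A = ω.toMeasure (A \ {t}) + A.indicator 1 t := by
  have hd : A \ {t} ∪ A ∩ {t} = A := Set.sdiff_union_inter A {t}
  have hm : MeasurableSet (A ∩ {t}) := hA.inter (measurableSet_singleton t)
  conv_lhs => rw [← hd]
  rw [measure_union (Set.disjoint_sdiff_inter) hm]
  congr 1
  · rw [toMeasure_apply _ (hA.diff (measurableSet_singleton t)),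
      toMeasure_apply _ (hA.diff (measurableSet_singleton t)), points_insert]
    congr 2
    ext x; simp; tauto
  · rw [toMeasure_apply _ hm, points_insert]
    by_cases ht : t ∈ A
    · have : Insert.insert t ω.points ∩ (A ∩ {t}) = {t} := by ext x; simp; aesop
      rw [this]; simp [ht]
    · have : Insert.insert t ω.points ∩ (A ∩ {t}) = ∅ := by ext x; simp; aesop
      rw [this]; simp [ht]

theorem measurable_toMeasure_diff_singleton {A : Set X} (hA : MeasurableSet A) :
    Measurable fun q : Configuration X × X => q.1.toMeasure (A \ {q.2}) := by
  have h : MeasurableSet {q : (Configuration X × X) × X | q.2 ∈ A ∧ q.2 ≠ q.1.2} :=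
    (measurable_snd hA).inter
      (measurableSet_eq_fun measurable_snd (measurable_snd.comp measurable_fst)).compl
  have h' := Kernel.measurable_kernel_prodMk_left
    (κ := (pointKernel X).comap (Prod.fst : Configuration X × X → _) measurable_fst) h
  simp only [Kernel.comap_apply, pointKernel_apply] at h'
  exact h'

theorem measurable_erase : Measurable fun q : Configuration X × X => q.1.erase q.2 :=
  measurable_of_toMeasure fun A hA => by
    simp_rw [toMeasure_erase_apply _ _ hA]
    exact measurable_toMeasure_diff_singleton hA

theorem measurable_insert : Measurable fun q : Configuration X × X => q.1.insert q.2 :=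
  measurable_of_toMeasure fun A hA => by
    simp_rw [toMeasure_insert_apply _ _ hA]
    exact (measurable_toMeasure_diff_singleton hA).add
      ((measurable_const.indicator hA).comp measurable_snd)

end Metric

end Configuration

end PoissonInvariance

/-! ### Poisson counts: from compact sets to bounded Borel sets -/

namespace PoissonInvariance

open Filter Topology

/-- The weights of the Poisson law satisfy `(n + 1) p_{n+1} = r p_n`. -/
theorem succ_mul_poissonMeasure_singleton_succ (r : ℝ≥0) (n : ℕ) :
    ((n + 1 : ℕ) : ℝ≥0∞) * poissonMeasure r {n + 1} = r * poissonMeasure r {n} := by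
  rw [poissonMeasure_singleton, poissonMeasure_singleton, ← ENNReal.ofReal_natCast,
    ← ENNReal.ofReal_coe_nnreal, ← ENNReal.ofReal_mul (by positivity),
    ← ENNReal.ofReal_mul (by positivity)]
  congr 1
  rw [Nat.factorial_succ]
  have : ((n.factorial : ℕ) : ℝ) ≠ 0 := by positivity
  push_cast
  field_simp
  ring

theorem lintegral_natCast_poissonMeasure (r : ℝ≥0) :
    ∫⁻ n, (n : ℝ≥0∞) ∂poissonMeasure r = r := by
  rw [lintegral_countable', tsum_eq_zero_add' ENNReal.summable]
  simp_rw [succ_mul_poissonMeasure_singleton_succ]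
  rw [ENNReal.tsum_mul_left]
  have h : ∑' n, poissonMeasure r {n} = 1 := by
    have h1 : poissonMeasure r Set.univ = 1 := measure_univ
    rw [← h1, ← lintegral_one, lintegral_countable']
    simp
  rw [h]; simp

theorem continuous_poissonMeasure_singleton (n : ℕ) :
    Continuous fun r : ℝ≥0 => poissonMeasure r {n} := by
  simp_rw [poissonMeasure_singleton]
  exact ENNReal.continuous_ofReal.comp (by fun_prop)

namespace IsPoissonMeasure

open PoissonInvariance.Configuration

variable {X : Type*} [MetricSpace X] [SigmaCompactSpace X] [MeasurableSpace X] [BorelSpace X]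
  {σ : Measure X} {P : Measure (Configuration X)}

/-- The mean measure of a Poisson measure is its intensity. -/
theorem bind_toMeasure [IsFiniteMeasureOnCompacts σ] (hP : IsPoissonMeasure σ P) :
    P.bind toMeasure = σ := by
  have hcompact : ∀ A : Set X, IsCompact A → P.bind toMeasure A = σ A := by
    intro A hA
    rw [Measure.bind_apply hA.measurableSet measurable_toMeasure.aemeasurable]
    simp_rw [toMeasure_eq_count _ hA.measurableSet hA subset_rfl]
    have h := lintegral_map (μ := P) (f := fun n : ℕ => (n : ℝ≥0∞)) (measurable_from_top)
      (measurable_count hA.measurableSet hA subset_rfl)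
    rw [← h, hP.map_count A hA, lintegral_natCast_poissonMeasure,
      ENNReal.coe_toNNReal hA.measure_lt_top.ne]
  -- Agreement on compact sets suffices: closed sets form a generating π-system, and each is an
  -- increasing union of compact sets.
  refine Measure.ext_of_generateFrom_of_iUnion {s | IsClosed s} (compactCovering X)
    (by rw [← borel_eq_generateFrom_isClosed]; exact BorelSpace.measurable_eq)
    isPiSystem_isClosed (iUnion_compactCovering X)
    (fun n => (isCompact_compactCovering X n).isClosed) (fun n => ?_) (fun s hs => ?_)
  · rw [hcompact _ (isCompact_compactCovering X n)]
    exact (isCompact_compactCovering X n).measure_lt_top.ne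
  · have hs' : s = ⋃ n, s ∩ compactCovering X n := by
      rw [← Set.inter_iUnion, iUnion_compactCovering, Set.inter_univ]
    have hmono : Monotone fun n => s ∩ compactCovering X n := fun a b hab =>
      Set.inter_subset_inter_right _ (compactCovering_subset X hab)
    rw [hs', hmono.measure_iUnion, hmono.measure_iUnion]
    exact iSup_congr fun n =>
      hcompact _ ((isCompact_compactCovering X n).inter_left hs)

/-- A null set of the intensity almost surely contains no point. -/
theorem ae_ae_toMeasure [IsFiniteMeasureOnCompacts σ] (hP : IsPoissonMeasure σ P)
    {p : X → Prop} (hp : ∀ᵐ t ∂σ, p t) : ∀ᵐ ω ∂P, ∀ᵐ t ∂ω.toMeasure, p t := by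
  rw [← hP.bind_toMeasure] at hp
  exact Measure.ae_ae_of_ae_bind measurable_toMeasure.aemeasurable hp

theorem measure_forall_count_eq_of_isCompact (hP : IsPoissonMeasure σ P)
    {J : Type*} [Fintype J] {A : J → Set X} (hA : ∀ j, IsCompact (A j))
    (hd : Pairwise (Function.onFun Disjoint A)) (n : J → ℕ) :
    P {ω | ∀ j, count (A j) ω = n j} = ∏ j, poissonMeasure (σ (A j)).toNNReal {n j} := by
  let e := (Fintype.equivFin J).symm
  have hi := hP.iIndepFun_count (Fintype.card J) (fun i => A (e i)) (fun i => hA _)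
    (fun i j hij => hd (e.injective.ne hij))
  have h := hi.measure_inter_preimage_eq_mul Finset.univ (sets := fun i => {n (e i)})
    (fun i _ => measurableSet_singleton _)
  have hset : {ω | ∀ j, count (A j) ω = n j} =
      ⋂ i ∈ (Finset.univ : Finset (Fin (Fintype.card J))), count (A (e i)) ⁻¹' {n (e i)} := by
    ext ω
    simp only [Set.mem_ofPred_eq, Finset.mem_univ, Set.iInter_true, Set.mem_iInter,
      Set.mem_preimage, Set.mem_singleton_iff]
    exact e.surjective.forall
  rw [hset, h, ← e.prod_comp]
  refine Finset.prod_congr rfl fun i _ => ?_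
  rw [← hP.map_count _ (hA _), Measure.map_apply
    (measurable_count (hA _).measurableSet (hA _) subset_rfl) (measurableSet_singleton _)]

/-- The numbers of points in disjoint Borel subsets of a compact set are independent and
Poisson distributed. -/
theorem measure_forall_count_eq [SigmaFinite σ] [IsFiniteMeasureOnCompacts σ]
    (hP : IsPoissonMeasure σ P)
    {J : Type*} [Fintype J] {B : J → Set X} (hB : ∀ j, MeasurableSet (B j)) {K : Set X}
    (hK : IsCompact K) (hBK : ∀ j, B j ⊆ K)
    (hd : Pairwise (Function.onFun Disjoint B)) (n : J → ℕ) :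
    P {ω | ∀ j, count (B j) ω = n j} = ∏ j, poissonMeasure (σ (B j)).toNNReal {n j} := by
  have := hP.isProbabilityMeasure
  have hBfin : ∀ j, σ (B j) ≠ ∞ := fun j =>
    ((measure_mono (hBK j)).trans_lt hK.measure_lt_top).ne
  -- Inner regularity. The finite unions D of these compact sets increase with i and exhaust B j up
  -- to a σ-null set.
  have hex : ∀ j (i : ℕ), ∃ C ⊆ B j, IsCompact C ∧ σ (B j \ C) < ((i : ℝ≥0∞) + 1)⁻¹ := fun j i =>
    (hB j).exists_isCompact_sdiff_lt (hBfin j) (by simp)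
  choose C hCB hCc hCσ using hex
  let D : J → ℕ → Set X := fun j => Set.accumulate (C j)
  have hDc : ∀ j i, IsCompact (D j i) := fun j i =>
    (Set.finite_Iic i).isCompact_biUnion fun k _ => hCc j k
  have hDB : ∀ j i, D j i ⊆ B j := fun j i =>
    (Set.accumulate_subset_iUnion i).trans (Set.iUnion_subset (hCB j))
  have hnull : ∀ j, σ (B j \ ⋃ i, C j i) = 0 := by
    intro j
    have hle : ∀ i : ℕ, σ (B j \ ⋃ i, C j i) ≤ ((i : ℝ≥0∞) + 1)⁻¹ := fun i =>
      (measure_mono (Set.sdiff_subset_sdiff_right (Set.subset_iUnion _ i))).trans (hCσ j i).le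
    have htend := (ENNReal.tendsto_inv_nat_nhds_zero).comp (tendsto_add_atTop_nat 1)
    refine le_antisymm (ge_of_tendsto' htend fun i => ?_) bot_le
    simpa using hle i
  have hσ : ∀ j, Tendsto (fun i => σ (D j i)) atTop (𝓝 (σ (B j))) := by
    intro j
    have h1 := tendsto_measure_iUnion_accumulate (μ := σ) (f := C j)
    have h2 : σ (⋃ i, C j i) = σ (B j) := by
      refine measure_congr ((LE.le.eventuallyLE (Set.iUnion_subset (hCB j))).antisymm ?_)
      rw [ae_le_set]
      exact hnull j
    rwa [h2] at h1
  -- Almost surely no point of ω falls in the null remainder, and only finitely many lie in B j;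
  -- hence the counts in D j i eventually stabilise at the count in B j.
  have hevent : ∀ᵐ ω ∂P, ∀ᶠ i in atTop, ∀ j, count (D j i) ω = count (B j) ω := by
    have h1 : ∀ᵐ ω ∂P, ∀ j, ∀ t ∈ ω.points, t ∈ B j → t ∈ ⋃ i, C j i := by
      rw [ae_all_iff]
      intro j
      have h2 : ∀ᵐ t ∂σ, t ∈ B j → t ∈ ⋃ i, C j i := by
        rw [ae_iff]
        simp only [Classical.not_imp]
        exact hnull j
      filter_upwards [hP.ae_ae_toMeasure h2] with ω hω
      exact ae_toMeasure_iff.1 hω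
    filter_upwards [h1] with ω hω
    rw [eventually_all]
    intro j
    have hfin : (ω.points ∩ B j).Finite :=
      (ω.2 K hK).subset (Set.inter_subset_inter_right _ (hBK j))
    have hsub : ∀ᶠ i in atTop, ω.points ∩ B j ⊆ D j i := by
      have : ∀ t ∈ ω.points ∩ B j, ∀ᶠ i in atTop, t ∈ D j i := by
        intro t ht
        obtain ⟨i, hi⟩ := Set.mem_iUnion.1 (hω j t ht.1 ht.2)
        filter_upwards [eventually_ge_atTop i] with k hk
        exact Set.mem_accumulate.2 ⟨i, hk, hi⟩
      exact (hfin.eventually_all).2 this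
    filter_upwards [hsub] with i hi
    unfold count
    congr 1
    exact Set.Subset.antisymm (Set.inter_subset_inter_right _ (hDB j i))
      (Set.subset_inter Set.inter_subset_left hi)
  have hlim1 : Tendsto (fun i => P {ω | ∀ j, count (D j i) ω = n j}) atTop
      (𝓝 (P {ω | ∀ j, count (B j) ω = n j})) := by
    refine tendsto_measure_of_ae_tendsto_indicator_of_isFiniteMeasure atTop ?_ ?_ ?_
    · simp_rw [Set.ofPred_forall]
      exact MeasurableSet.iInter fun j =>
        measurable_count (hB j) hK (hBK j) (measurableSet_singleton (n j))
    · intro i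
      simp_rw [Set.ofPred_forall]
      exact MeasurableSet.iInter fun j =>
        measurable_count (hDc j i).measurableSet (hDc j i) subset_rfl (measurableSet_singleton (n j))
    · filter_upwards [hevent] with ω hω
      filter_upwards [hω] with i hi
      simp only [hi]
  have hlim2 : Tendsto (fun i => P {ω | ∀ j, count (D j i) ω = n j}) atTop
      (𝓝 (∏ j, poissonMeasure (σ (B j)).toNNReal {n j})) := by
    have : ∀ i, P {ω | ∀ j, count (D j i) ω = n j} =
        ∏ j, poissonMeasure (σ (D j i)).toNNReal {n j} := fun i =>
      hP.measure_forall_count_eq_of_isCompact (fun j => hDc j i)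
        (fun a b hab => (hd hab).mono (hDB a i) (hDB b i)) n
    simp_rw [this]
    refine ENNReal.tendsto_finsetProd_of_ne_top _ (fun j _ => ?_) (fun j _ => measure_ne_top _ _)
    exact ((continuous_poissonMeasure_singleton (n j)).tendsto _).comp
      ((ENNReal.tendsto_toNNReal (hBfin j)).comp (hσ j))
  exact tendsto_nhds_unique hlim1 hlim2

end IsPoissonMeasure

end PoissonInvariance

/-! ### The Mecke formula -/

namespace PoissonInvariance

namespace Configuration

variable {X : Type*} [MetricSpace X] [SigmaCompactSpace X] [MeasurableSpace X] [BorelSpace X]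

/-- The reduced Campbell measure `E ∑_{t ∈ ω} ε_{(ω \ {t}, t)}`. -/
noncomputable def campbell (P : Measure (Configuration X)) : Measure (Configuration X × X) :=
  (P ⊗ₘ pointKernel X).map fun q => (q.1.erase q.2, q.2)

theorem measurable_erase_prodMk :
    Measurable fun q : Configuration X × X => (q.1.erase q.2, q.2) :=
  measurable_erase.prodMk measurable_snd

theorem lintegral_campbell {P : Measure (Configuration X)} [SFinite P]
    {G : Configuration X × X → ℝ≥0∞} (hG : Measurable G) :
    ∫⁻ q, G q ∂campbell P = ∫⁻ ω, ∫⁻ t, G (ω.erase t, t) ∂ω.toMeasure ∂P := by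
  rw [campbell, lintegral_map hG measurable_erase_prodMk]
  exact Measure.lintegral_compProd (hG.comp measurable_erase_prodMk)

theorem count_erase_of_mem {ω : Configuration X} {t : X} {A K : Set X} (hK : IsCompact K)
    (hAK : A ⊆ K) (ht : t ∈ ω.points) (htA : t ∈ A) :
    count A (ω.erase t) + 1 = count A ω := by
  have hfin : (ω.points ∩ A).Finite :=
    (ω.2 K hK).subset (Set.inter_subset_inter_right _ hAK)
  unfold count
  have hmem : t ∈ ω.points ∩ A := ⟨ht, htA⟩
  rw [points_erase, ← Set.ncard_sdiff_singleton_add_one hmem hfin]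
  congr 2
  ext x; simp; tauto

theorem count_erase_of_notMem {ω : Configuration X} {t : X} {A : Set X} (htA : t ∉ A) :
    count A (ω.erase t) = count A ω := by
  unfold count
  rw [points_erase]
  congr 1
  ext x
  simp only [Set.mem_inter_iff, Set.mem_sdiff, Set.mem_singleton_iff]
  refine and_congr_left fun hx => ⟨fun h => h.1, fun h => ⟨h, ?_⟩⟩
  rintro rfl
  exact htA hx

/-- The bounded Borel sets. -/
def boundedSets (X : Type*) [TopologicalSpace X] [MeasurableSpace X] : Set (Set X) :=
  {A | MeasurableSet A ∧ ∃ K, IsCompact K ∧ A ⊆ K}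

theorem isPiSystem_boundedSets : IsPiSystem (boundedSets X) := by
  rintro A ⟨hA, K, hK, hAK⟩ B ⟨hB, -⟩ -
  exact ⟨hA.inter hB, K, hK, Set.inter_subset_left.trans hAK⟩

theorem inter_compactCovering_mem_boundedSets {A : Set X} (hA : MeasurableSet A) (n : ℕ) :
    A ∩ compactCovering X n ∈ boundedSets X :=
  ⟨hA.inter (measurableSet_compactCovering n), _, isCompact_compactCovering X n,
    Set.inter_subset_right⟩

theorem iUnion_inter_compactCovering (A : Set X) : ⋃ n, A ∩ compactCovering X n = A := by
  rw [← Set.inter_iUnion, iUnion_compactCovering, Set.inter_univ]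

theorem generateFrom_boundedSets :
    MeasurableSpace.generateFrom (boundedSets X) = (inferInstance : MeasurableSpace X) := by
  refine le_antisymm (MeasurableSpace.generateFrom_le fun A hA => hA.1) fun A hA => ?_
  rw [← iUnion_inter_compactCovering A]
  exact MeasurableSet.iUnion fun n =>
    MeasurableSpace.measurableSet_generateFrom (inter_compactCovering_mem_boundedSets hA n)

/-- The events that constrain the numbers of points in finitely many bounded sets. -/
def countEvents (X : Type*) [TopologicalSpace X] [MeasurableSpace X] :
    Set (Set (Configuration X)) :=
  piiUnionInter (fun A : Set X => {E | MeasurableSet[MeasurableSpace.comap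
    (fun ω : Configuration X => ω.toMeasure A) inferInstance] E}) (boundedSets X)

theorem isPiSystem_countEvents : IsPiSystem (countEvents X) :=
  isPiSystem_piiUnionInter _ (fun _ => @MeasurableSpace.isPiSystem_measurableSet _ (_)) _

theorem generateFrom_countEvents :
    MeasurableSpace.generateFrom (countEvents X) =
      (inferInstance : MeasurableSpace (Configuration X)) := by
  have hgen := generateFrom_piiUnionInter_measurableSet (fun A : Set X => MeasurableSpace.comap
    (fun ω : Configuration X => ω.toMeasure A) inferInstance) (boundedSets X)
  refine hgen.trans ?_
  refine le_antisymm (iSup₂_le fun A hA => ?_) ?_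
  · exact (measurable_toMeasure_apply hA.1).comap_le
  · set m := ⨆ i ∈ boundedSets X, MeasurableSpace.comap
      (fun ω : Configuration X => ω.toMeasure i) inferInstance with hm
    have hmeas : ∀ A ∈ boundedSets X, Measurable[m] fun ω : Configuration X => ω.toMeasure A := by
      intro A hA
      rw [measurable_iff_comap_le]
      exact le_iSup₂_of_le A hA le_rfl
    have : Measurable[m] (toMeasure : Configuration X → Measure X) := by
      refine @Measure.measurable_of_measurable_coe _ _ _ m _ fun A hA => ?_
      have hmono : Monotone fun n => A ∩ compactCovering X n := fun a b hab =>
        Set.inter_subset_inter_right _ (compactCovering_subset X hab)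
      have heq : (fun ω : Configuration X => ω.toMeasure A) =
          fun ω => ⨆ n, ω.toMeasure (A ∩ compactCovering X n) := by
        funext ω
        rw [← hmono.measure_iUnion, iUnion_inter_compactCovering]
      rw [heq]
      refine Measurable.iSup fun n => ?_
      exact hmeas _ (inter_compactCovering_mem_boundedSets hA n)
    exact measurable_iff_comap_le.1 this

end Configuration

namespace IsPoissonMeasure

open PoissonInvariance.Configuration

variable {X : Type*} [MetricSpace X] [SigmaCompactSpace X] [MeasurableSpace X] [BorelSpace X]
  {σ : Measure X} {P : Measure (Configuration X)}

section Atoms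

variable {J : Type*} [Fintype J] {B : J → Set X} {K : Set X}

/-- Removing a point of B j₀ lowers the count there by one and no other. So either no t contributes,
or all the n j₀ + 1 points of ω in B j₀ do. -/
theorem lintegral_count_erase_atom (ω : Configuration X) (hB : ∀ j, MeasurableSet (B j))
    (hK : IsCompact K) (hBK : ∀ j, B j ⊆ K) (hd : Pairwise (Function.onFun Disjoint B))
    (j₀ : J) (n : J → ℕ) [DecidableEq J] :
    ∫⁻ t, {t | t ∈ B j₀ ∧ ∀ j, count (B j) (ω.erase t) = n j}.indicator 1 t ∂ω.toMeasure =
      ((n j₀ + 1 : ℕ) : ℝ≥0∞) *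
        {ω | ∀ j, count (B j) ω = (n + Pi.single j₀ 1 : J → ℕ) j}.indicator 1 ω := by
  have key : ∀ t ∈ ω.points, (t ∈ B j₀ ∧ ∀ j, count (B j) (ω.erase t) = n j) ↔
      (t ∈ B j₀ ∧ ∀ j, count (B j) ω = (n + Pi.single j₀ 1 : J → ℕ) j) := by
    intro t ht
    refine and_congr_right fun htB => forall_congr' fun j => ?_
    by_cases hj : j = j₀
    · subst hj
      rw [← count_erase_of_mem hK (hBK j) ht htB]
      simp
    · rw [count_erase_of_notMem (Set.disjoint_left.1 (hd (Ne.symm hj)) htB)]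
      simp [hj]
  have h1 : ∀ᵐ t ∂ω.toMeasure,
      {t | t ∈ B j₀ ∧ ∀ j, count (B j) (ω.erase t) = n j}.indicator (1 : X → ℝ≥0∞) t =
      (B j₀).indicator (fun _ =>
        {ω | ∀ j, count (B j) ω = (n + Pi.single j₀ 1 : J → ℕ) j}.indicator 1 ω) t := by
    rw [ae_toMeasure_iff]
    intro t ht
    have hk := key t ht
    classical
    simp only [Set.indicator_apply, Set.mem_ofPred_eq, Pi.one_apply] at hk ⊢
    by_cases htB : t ∈ B j₀
    · simp only [htB, true_and, if_true] at hk ⊢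
      exact if_congr hk rfl rfl
    · simp [htB]
  rw [lintegral_congr_ae h1, lintegral_indicator (hB j₀), setLIntegral_const, mul_comm]
  by_cases hω : ∀ j, count (B j) ω = (n + Pi.single j₀ 1 : J → ℕ) j
  · rw [toMeasure_eq_count ω (hB j₀) hK (hBK j₀), hω j₀]
    simp
  · have : ω ∉ {ω | ∀ j, count (B j) ω = (n + Pi.single j₀ 1 : J → ℕ) j} := hω
    simp only [Set.indicator_of_notMem this, mul_zero]

theorem measurable_count_family (hB : ∀ j, MeasurableSet (B j)) (hK : IsCompact K)
    (hBK : ∀ j, B j ⊆ K) : Measurable fun (ω : Configuration X) j => count (B j) ω :=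
  measurable_pi_lambda _ fun j => measurable_count (hB j) hK (hBK j)

/-- This is the recursion (n + 1) p_{n+1} = r p_n of the Poisson weights in the coordinate j₀;
independence leaves the other factors unchanged. -/
theorem campbell_atom_singleton [SigmaFinite σ] [IsFiniteMeasureOnCompacts σ]
    (hP : IsPoissonMeasure σ P) (hB : ∀ j, MeasurableSet (B j))
    (hK : IsCompact K) (hBK : ∀ j, B j ⊆ K) (hd : Pairwise (Function.onFun Disjoint B))
    (j₀ : J) (n : J → ℕ) :
    campbell P ({ω | (fun j => count (B j) ω) = n} ×ˢ B j₀) =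
      P {ω | (fun j => count (B j) ω) = n} * σ (B j₀) := by
  classical
  have := hP.isProbabilityMeasure
  have hN : Measurable fun (ω : Configuration X) j => count (B j) ω :=
    measurable_count_family hB hK hBK
  have hE : ∀ n : J → ℕ, MeasurableSet {ω : Configuration X | ∀ j, count (B j) ω = n j} := by
    intro n
    simp_rw [← funext_iff]
    exact hN (measurableSet_singleton n)
  simp_rw [funext_iff]
  rw [← lintegral_indicator_one ((hE n).prod (hB j₀)), lintegral_campbell
    (measurable_one.indicator ((hE n).prod (hB j₀)))]
  have h1 : ∀ ω : Configuration X, ∫⁻ t,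
      ({ω | ∀ j, count (B j) ω = n j} ×ˢ B j₀).indicator 1 (ω.erase t, t) ∂ω.toMeasure =
      ((n j₀ + 1 : ℕ) : ℝ≥0∞) *
        {ω | ∀ j, count (B j) ω = (n + Pi.single j₀ 1 : J → ℕ) j}.indicator 1 ω := by
    intro ω
    rw [← lintegral_count_erase_atom ω hB hK hBK hd j₀ n]
    refine lintegral_congr fun t => ?_
    simp only [Set.indicator_apply, Set.mem_prod, Set.mem_ofPred_eq, and_comm]
    rfl
  simp_rw [h1]
  rw [lintegral_const_mul _ (measurable_one.indicator (hE _)), lintegral_indicator_one (hE _),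
    hP.measure_forall_count_eq hB hK hBK hd, hP.measure_forall_count_eq hB hK hBK hd,
    ← Finset.mul_prod_erase _ _ (Finset.mem_univ j₀), ← Finset.mul_prod_erase _ _
      (Finset.mem_univ j₀)]
  have h2 : ∏ j ∈ Finset.univ.erase j₀,
      poissonMeasure (σ (B j)).toNNReal {(n + Pi.single j₀ 1 : J → ℕ) j} =
      ∏ j ∈ Finset.univ.erase j₀, poissonMeasure (σ (B j)).toNNReal {n j} :=
    Finset.prod_congr rfl fun j hj => by simp [Finset.ne_of_mem_erase hj]
  have h3 : (n + Pi.single j₀ 1 : J → ℕ) j₀ = n j₀ + 1 := by simp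
  have hfin : σ (B j₀) ≠ ∞ := ((measure_mono (hBK j₀)).trans_lt hK.measure_lt_top).ne
  rw [h2, h3, ← mul_assoc, succ_mul_poissonMeasure_singleton_succ, ENNReal.coe_toNNReal hfin]
  ring

theorem campbell_atom [SigmaFinite σ] [IsFiniteMeasureOnCompacts σ]
    (hP : IsPoissonMeasure σ P) (hB : ∀ j, MeasurableSet (B j))
    (hK : IsCompact K) (hBK : ∀ j, B j ⊆ K) (hd : Pairwise (Function.onFun Disjoint B))
    (j₀ : J) (M : Set (J → ℕ)) :
    campbell P ({ω | (fun j => count (B j) ω) ∈ M} ×ˢ B j₀) =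
      P {ω | (fun j => count (B j) ω) ∈ M} * σ (B j₀) := by
  have hN : Measurable fun (ω : Configuration X) j => count (B j) ω :=
    measurable_count_family hB hK hBK
  have hM : {ω : Configuration X | (fun j => count (B j) ω) ∈ M} =
      ⋃ n : M, {ω : Configuration X | (fun j => count (B j) ω) = n} := by
    ext ω; simp
  have hdisj : Pairwise (Function.onFun Disjoint
      fun n : M => {ω : Configuration X | (fun j => count (B j) ω) = n}) := by
    intro a b hab
    refine Set.disjoint_left.2 fun ω h1 h2 => hab (Subtype.ext ?_)
    exact h1.symm.trans h2
  have hmeas : ∀ n : M, MeasurableSet {ω : Configuration X | (fun j => count (B j) ω) = n} :=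
    fun n => hN (measurableSet_singleton (n : J → ℕ))
  rw [hM, Set.iUnion_prod_const, measure_iUnion (fun a b hab =>
    Set.disjoint_prod.2 (Or.inl (hdisj hab))) (fun n => (hmeas n).prod (hB j₀)),
    measure_iUnion hdisj hmeas, ← ENNReal.tsum_mul_right]
  exact tsum_congr fun n => hP.campbell_atom_singleton hB hK hBK hd j₀ n

end Atoms

/-- The sets constraining E may overlap each other and A. Cutting a compact K that contains them all
into the atoms of the algebra they generate turns E into a condition on disjoint counts and A into a
union of atoms. -/
theorem campbell_prod [SigmaFinite σ] [IsFiniteMeasureOnCompacts σ]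
    (hP : IsPoissonMeasure σ P) {E : Set (Configuration X)} (hE : E ∈ countEvents X)
    {A : Set X} (hA : A ∈ boundedSets X) :
    campbell P (E ×ˢ A) = P E * σ A := by
  classical
  obtain ⟨s, hs, f, hf, rfl⟩ := hE
  set t : Finset (Set X) := insert A s with ht
  have htb : ∀ S ∈ t, S ∈ boundedSets X := by
    intro S hS
    rcases Finset.mem_insert.1 hS with rfl | h
    · exact hA
    · exact hs h
  choose! K' hK' hSK' using fun S hS => (htb S hS).2
  set K : Set X := ⋃ S ∈ t, K' S with hKdef
  have hK : IsCompact K := t.finite_toSet.isCompact_biUnion fun S hS => hK' S hS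
  have hSK : ∀ S ∈ t, S ⊆ K := fun S hS => (hSK' S hS).trans (Set.subset_biUnion_of_mem
    (u := K') (Finset.mem_coe.2 hS))
  let B : (t → Bool) → Set X := fun j => {x | x ∈ K ∧ ∀ S : t, (x ∈ (S : Set X)) ↔ j S = true}
  have hBm : ∀ j, MeasurableSet (B j) := by
    intro j
    have : B j = K ∩ ⋂ S : t, (if j S = true then (S : Set X) else (S : Set X)ᶜ) := by
      ext x
      simp only [B, Set.mem_ofPred_eq, Set.mem_inter_iff, Set.mem_iInter]
      refine and_congr_right fun _ => forall_congr' fun S => ?_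
      by_cases h : j S = true <;> simp [h]
    rw [this]
    refine hK.measurableSet.inter (MeasurableSet.iInter fun S => ?_)
    split_ifs
    · exact (htb S S.2).1
    · exact (htb S S.2).1.compl
  have hBK : ∀ j, B j ⊆ K := fun j x hx => hx.1
  have hd : Pairwise (Function.onFun Disjoint B) := by
    intro a b hab
    refine Set.disjoint_left.2 fun x h1 h2 => hab (funext fun S => ?_)
    exact Bool.eq_iff_iff.2 ((h1.2 S).symm.trans (h2.2 S))
  have hS : ∀ S : t, (S : Set X) =
      ⋃ j ∈ (Finset.univ.filter fun j : t → Bool => j S = true), B j := by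
    intro S
    ext x
    simp only [Finset.mem_filter, Finset.mem_univ, true_and, Set.mem_iUnion, exists_prop]
    constructor
    · intro hx
      exact ⟨fun S' => decide (x ∈ (S' : Set X)), by simpa using hx, hSK S S.2 hx, by simp⟩
    · rintro ⟨j, hj, hx⟩
      exact (hx.2 S).2 hj
  have hsum : ∀ (ρ : Measure X) (S : t), ρ S =
      ∑ j ∈ (Finset.univ.filter fun j : t → Bool => j S = true), ρ (B j) := by
    intro ρ S
    conv_lhs => rw [hS S]
    exact measure_biUnion_finset (fun a _ b _ hab => hd hab) fun j _ => hBm j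
  have hV : ∀ S ∈ s, ∃ V : Set ℝ≥0∞, (fun ω : Configuration X => ω.toMeasure S) ⁻¹' V = f S := by
    intro S hS'
    obtain ⟨V, -, hV⟩ := hf S hS'
    exact ⟨V, hV⟩
  choose! V hV using hV
  let M : Set ((t → Bool) → ℕ) := {n | ∀ S : t, (S : Set X) ∈ s →
    ∑ j ∈ (Finset.univ.filter fun j : t → Bool => j S = true), (n j : ℝ≥0∞) ∈ V S}
  have hE : (⋂ S ∈ s, f S) = {ω : Configuration X | (fun j => count (B j) ω) ∈ M} := by
    ext ω
    simp only [Set.mem_iInter, M, Set.mem_ofPred_eq]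
    have hc : ∀ S : t, ∑ j ∈ (Finset.univ.filter fun j : t → Bool => j S = true),
        (count (B j) ω : ℝ≥0∞) = ω.toMeasure S := by
      intro S
      rw [hsum]
      exact Finset.sum_congr rfl fun j _ => (toMeasure_eq_count ω (hBm j) hK (hBK j)).symm
    simp_rw [hc]
    constructor
    · intro h S hSs
      have := h S hSs
      rw [← hV S hSs] at this
      exact this
    · intro h S hSs
      rw [← hV S hSs]
      exact h ⟨S, Finset.mem_insert_of_mem hSs⟩ hSs
  have hAt : A ∈ t := Finset.mem_insert_self _ _
  rw [hE]
  have hEm : MeasurableSet {ω : Configuration X | (fun j => count (B j) ω) ∈ M} :=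
    measurable_count_family hBm hK hBK (Set.to_countable M).measurableSet
  rw [hsum σ ⟨A, hAt⟩, Finset.mul_sum]
  simp_rw [← hP.campbell_atom hBm hK hBK hd _ M]
  rw [← measure_biUnion_finset]
  · rw [← Set.prod_iUnion₂, ← hS ⟨A, hAt⟩]
  · intro a _ b _ hab
    exact Set.disjoint_prod.2 (Or.inr (hd hab))
  · exact fun j _ => hEm.prod (hBm j)

/-- The Mecke formula. -/
theorem campbell_eq_prod [SigmaFinite σ] [IsFiniteMeasureOnCompacts σ]
    (hP : IsPoissonMeasure σ P) : campbell P = P.prod σ := by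
  have := hP.isProbabilityMeasure
  symm
  refine Measure.prod_eq_generateFrom generateFrom_countEvents generateFrom_boundedSets
    isPiSystem_countEvents isPiSystem_boundedSets ?_ ?_
    (fun E hE A hA => hP.campbell_prod hE hA)
  · exact ⟨fun _ => Set.univ, fun _ => ⟨∅, by simp, fun _ => Set.univ, by simp, by simp⟩,
      fun _ => measure_lt_top _ _, Set.iUnion_const _⟩
  · exact ⟨compactCovering X, fun n => ⟨measurableSet_compactCovering n, _,
      isCompact_compactCovering X n, subset_rfl⟩,
      fun n => (isCompact_compactCovering X n).measure_lt_top, iUnion_compactCovering X⟩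

/-- The Mecke formula for nonnegative functions. -/
theorem lintegral_lintegral_erase [SigmaFinite σ] [IsFiniteMeasureOnCompacts σ]
    (hP : IsPoissonMeasure σ P) {G : Configuration X × X → ℝ≥0∞} (hG : Measurable G) :
    ∫⁻ ω, ∫⁻ t, G (ω.erase t, t) ∂ω.toMeasure ∂P = ∫⁻ ω, ∫⁻ t, G (ω, t) ∂σ ∂P := by
  have := hP.isProbabilityMeasure
  rw [← lintegral_campbell hG, hP.campbell_eq_prod, lintegral_prod _ hG.aemeasurable]

/-- Adding a point distributed according to the intensity preserves null sets. -/
theorem quasiMeasurePreserving_insert [SigmaFinite σ] [IsFiniteMeasureOnCompacts σ]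
    (hP : IsPoissonMeasure σ P) :
    Measure.QuasiMeasurePreserving (fun q : Configuration X × X => q.1.insert q.2)
      (P.prod σ) P := by
  have := hP.isProbabilityMeasure
  refine ⟨measurable_insert, Measure.AbsolutelyContinuous.mk fun N hN hPN => ?_⟩
  rw [Measure.map_apply measurable_insert hN, ← hP.campbell_eq_prod,
    ← lintegral_indicator_one (measurable_insert hN),
    lintegral_campbell (measurable_one.indicator (measurable_insert hN))]
  refine (lintegral_eq_zero_iff' ?_).2 ?_
  · exact (measurable_lintegral_toMeasure (G := fun ω t =>
      ((fun q : Configuration X × X => q.1.insert q.2) ⁻¹' N).indicator 1 (ω.erase t, t))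
      measurable_id
      ((measurable_one.indicator (measurable_insert hN)).comp
        measurable_erase_prodMk)).aemeasurable
  -- Under the Campbell measure the inserted point is one that was just removed, so insertion
  -- returns the original ω.
  · have hae : ∀ᵐ ω ∂P, ω ∉ N := measure_eq_zero_iff_ae_notMem.1 hPN
    filter_upwards [hae] with ω hω
    refine lintegral_eq_zero_of_ae_eq_zero (ae_toMeasure_iff.2 fun t ht => ?_)
    have : (ω.erase t, t) ∉ (fun q : Configuration X × X => q.1.insert q.2) ⁻¹' N := by
      simpa [insert_erase ht] using hω
    simp [Set.indicator_of_notMem this]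

end IsPoissonMeasure

end PoissonInvariance

/-! ### Adding finitely many independent points -/

namespace PoissonInvariance

/-- Reading distinct coordinates preserves null sets of product measures. -/
theorem quasiMeasurePreserving_comp_of_injective {X ι κ : Type*} [MeasurableSpace X] [Fintype ι]
    [Fintype κ] (σ : Measure X) [SigmaFinite σ] {e : κ → ι} (he : Function.Injective e) :
    Measure.QuasiMeasurePreserving (fun (s : ι → X) k => s (e k))
      (Measure.pi fun _ => σ) (Measure.pi fun _ => σ) := by
  classical
  let _ : Fintype {i // i ∈ Set.range e} := Subtype.fintype _
  have h1 := (measurePreserving_piEquivPiSubtypeProd (fun _ : ι => σ)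
    (fun i => i ∈ Set.range e)).quasiMeasurePreserving
  have h2 := (Measure.quasiMeasurePreserving_fst
    (μ := Measure.pi fun _ : {i // i ∈ Set.range e} => σ)
    (ν := Measure.pi fun _ : {i // i ∉ Set.range e} => σ)).comp h1
  have h3 := (measurePreserving_piCongrLeft (fun _ : κ => σ)
    (Equiv.ofInjective e he).symm).quasiMeasurePreserving.comp h2
  convert h3 using 1
  funext s k
  obtain ⟨r, rfl⟩ := (Equiv.ofInjective e he).symm.surjective k
  simp only [Function.comp_apply, MeasurableEquiv.coe_piCongrLeft]
  rw [Equiv.piCongrLeft_apply_apply]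
  have : e ((Equiv.ofInjective e he).symm r) = r := Equiv.apply_ofInjective_symm he r
  rw [this]
  rfl

namespace Configuration

section Topological

variable {X : Type*} [TopologicalSpace X] {ι : Type*}

/-- The configuration `ω ∪ {s i | i ∈ S}`. -/
def addPoints (s : ι → X) (S : Finset ι) (ω : Configuration X) : Configuration X :=
  ⟨ω.points ∪ s '' S, fun K hK => by
    rw [Set.union_inter_distrib_right]
    exact (ω.2 K hK).union ((S.finite_toSet.image s).inter_of_left K)⟩

@[simp]
theorem points_addPoints (s : ι → X) (S : Finset ι) (ω : Configuration X) :
    (addPoints s S ω).points = ω.points ∪ s '' S := rfl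

@[simp]
theorem addPoints_empty (s : ι → X) (ω : Configuration X) : addPoints s ∅ ω = ω := by
  ext1; simp

theorem addPoints_insert [DecidableEq ι] (s : ι → X) (S : Finset ι) (p : ι)
    (ω : Configuration X) :
    addPoints s (Insert.insert p S) ω = (addPoints s S ω).insert (s p) := by
  ext1
  simp only [points_addPoints, points_insert, Finset.coe_insert, Set.image_insert_eq,
    Set.union_insert]

theorem addPoints_comp {κ : Type*} (e : κ ↪ ι) (s : ι → X) (S : Finset κ) (ω : Configuration X) :
    addPoints (fun k => s (e k)) S ω = addPoints s (S.map e) ω := by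
  ext1
  simp only [points_addPoints, Finset.coe_map, Set.image_image]

end Topological

theorem measurable_addPoints {X : Type*} [MetricSpace X] [SigmaCompactSpace X]
    [MeasurableSpace X] [BorelSpace X] {ι : Type*} (S : Finset ι) :
    Measurable fun q : Configuration X × (ι → X) => addPoints q.2 S q.1 := by
  classical
  induction S using Finset.induction_on with
  | empty => simpa using measurable_fst
  | insert p S hp ih =>
    simp_rw [addPoints_insert]
    exact measurable_insert.comp (ih.prodMk ((measurable_pi_apply p).comp measurable_snd))

end Configuration

namespace IsPoissonMeasure

open PoissonInvariance.Configuration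

variable {X : Type*} [MetricSpace X] [SigmaCompactSpace X] [MeasurableSpace X] [BorelSpace X]
  {σ : Measure X} [SigmaFinite σ] [IsFiniteMeasureOnCompacts σ] {P : Measure (Configuration X)}

/-- Adding the points with index in `S` to the configuration and keeping other points
preserves null sets. -/
theorem quasiMeasurePreserving_addPoints (hP : IsPoissonMeasure σ P) {ι : Type*} [Fintype ι]
    (S : Finset ι) : ∀ (k : ℕ) (e : Fin k → ι), Function.Injective e → (∀ j, e j ∉ S) →
    Measure.QuasiMeasurePreserving
      (fun q : Configuration X × (ι → X) => (addPoints q.2 S q.1, fun j => q.2 (e j)))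
      (P.prod (Measure.pi fun _ => σ)) (P.prod (Measure.pi fun _ => σ)) := by
  classical
  have := hP.isProbabilityMeasure
  induction S using Finset.induction_on with
  | empty =>
    intro k e he _
    simp only [addPoints_empty]
    exact QuasiMeasurePreserving.prodMap (Measure.QuasiMeasurePreserving.id P)
      (quasiMeasurePreserving_comp_of_injective σ he)
  | insert p S hp ih =>
    intro k e he heS
    have hep : ∀ j, e j ≠ p := fun j h => heS j (h ▸ Finset.mem_insert_self _ _)
    -- The induction hypothesis is used with s p as one more kept point, placed in front; being
    -- still fresh for the enlarged configuration, it can then be inserted as a single point.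
    have h1 := ih (k + 1) (Fin.cons p e) (Fin.cons_injective_iff.2
      ⟨fun ⟨j, hj⟩ => hep j hj, he⟩) (fun j => by
        refine Fin.cases ?_ (fun j => ?_) j
        · simpa using hp
        · simpa using fun h => heS j (Finset.mem_insert_of_mem h))
    have h2 := QuasiMeasurePreserving.prodMap (Measure.QuasiMeasurePreserving.id P)
      (measurePreserving_piFinSuccAbove (fun _ : Fin (k + 1) => σ) 0).quasiMeasurePreserving
    have h3 := (measurePreserving_prodAssoc P σ
      (Measure.pi fun _ : Fin k => σ)).symm.quasiMeasurePreserving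
    have h4 := QuasiMeasurePreserving.prodMap hP.quasiMeasurePreserving_insert
      (Measure.QuasiMeasurePreserving.id (Measure.pi fun _ : Fin k => σ))
    have h5 := h4.comp (h3.comp (h2.comp h1))
    convert h5 using 1
    funext q
    rw [addPoints_insert]
    rfl

theorem quasiMeasurePreserving_addPoints_fst (hP : IsPoissonMeasure σ P) {ι : Type*} [Fintype ι]
    (S : Finset ι) : Measure.QuasiMeasurePreserving
      (fun q : Configuration X × (ι → X) => addPoints q.2 S q.1)
      (P.prod (Measure.pi fun _ => σ)) P := by
  have := hP.isProbabilityMeasure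
  exact Measure.quasiMeasurePreserving_fst.comp
    (hP.quasiMeasurePreserving_addPoints S 0 Fin.elim0 (fun a => a.elim0) (fun a => a.elim0))

end IsPoissonMeasure

/-! ### Joint values at the added points -/

section Box

open PoissonInvariance.Configuration

variable {X : Type*} [MetricSpace X] [SigmaCompactSpace X] [MeasurableSpace X] [BorelSpace X]
  {σ : Measure X} [SigmaFinite σ] [IsFiniteMeasureOnCompacts σ] {P : Measure (Configuration X)}
  {u : Configuration X → X → ℝ}

/-- The value of the process at the point `s p`, when the points `s i`, `i ∈ S`, `i ≠ p`, are added
to the configuration, lies in `B p` for all `p`. -/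
def boxEvent {ι : Type*} [DecidableEq ι] (u : Configuration X → X → ℝ) (B : ι → Set ℝ)
    (S : Finset ι) : Set (Configuration X × (ι → X)) :=
  {q | ∀ p, u (addPoints q.2 (S.erase p) q.1) (q.2 p) ∈ B p}

theorem measurable_addPoints_apply {ι : Type*} [DecidableEq ι]
    (hu : Measurable (Function.uncurry u)) (S : Finset ι) (p : ι) :
    Measurable fun q : Configuration X × (ι → X) => u (addPoints q.2 S q.1) (q.2 p) :=
  hu.comp ((measurable_addPoints S).prodMk ((measurable_pi_apply p).comp measurable_snd))

theorem measurableSet_boxEvent {ι : Type*} [Fintype ι] [DecidableEq ι]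
    (hu : Measurable (Function.uncurry u)) {B : ι → Set ℝ} (hB : ∀ p, MeasurableSet (B p))
    (S : Finset ι) : MeasurableSet (boxEvent u B S) := by
  unfold boxEvent
  simp_rw [Set.ofPred_forall]
  exact MeasurableSet.iInter fun p => measurable_addPoints_apply hu _ p (hB p)

/-- The cyclic condition makes the dependence of the process on added points acyclic. -/
theorem ae_isAcyclicNetwork (hP : IsPoissonMeasure σ P) (hcyc : CyclicCondition σ P u)
    {ι : Type*} [Fintype ι] [DecidableEq ι] (B : ι → Set ℝ) :
    ∀ᵐ q ∂(P.prod (Measure.pi fun _ : ι => σ)), IsAcyclicNetwork fun p S =>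
      (open Classical in decide (u (addPoints q.2 (S.erase p) q.1) (q.2 p) ∈ B p)) := by
  classical
  -- There are only countably many triples (S, m, e). For each one the cyclic condition is applied
  -- at ω ∪ s_S to the points s (e j), which are fresh because e is injective and avoids S.
  have h : ∀ᵐ q ∂(P.prod (Measure.pi fun _ : ι => σ)), ∀ (S : Finset ι) (m : ℕ)
      (e : Fin (m + 2) → ι), Function.Injective e → (∀ j, e j ∉ S) →
      ∏ i, diff (q.2 (e i)) (fun ω => u ω (q.2 (e (i + 1)))) (addPoints q.2 S q.1) = 0 := by
    rw [ae_all_iff]; intro S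
    rw [ae_all_iff]; intro m
    rw [ae_all_iff]; intro e
    rw [Filter.eventually_imp_distrib_left]; intro he
    rw [Filter.eventually_imp_distrib_left]; intro heS
    exact (hP.quasiMeasurePreserving_addPoints S (m + 2) e he heS).ae (hcyc m)
  filter_upwards [h] with q hq
  refine ⟨fun p S => ?_, fun S m e he heS => ?_⟩
  · rw [Finset.erase_insert_eq_erase]
  · obtain ⟨j, -, hj⟩ := Finset.prod_eq_zero_iff.1 (hq S m e he heS)
    refine ⟨j, ?_⟩
    have hne : e (j + 1) ≠ e j := fun h => by simpa using he h
    -- Since e (j + 1) is neither in S nor equal to e j, the erasures in the network do nothing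
    -- here, and a vanishing difference says that the value is unchanged.
    have h1 : (insert (e j) S).erase (e (j + 1)) = insert (e j) S :=
      Finset.erase_eq_of_notMem (by simp [hne, heS])
    have h2 : S.erase (e (j + 1)) = S := Finset.erase_eq_of_notMem (heS _)
    rw [h1, h2, addPoints_insert]
    rw [diff, sub_eq_zero] at hj
    rw [hj]

/-- `ν` is the law of `u ω` away from `0`, for almost every configuration `ω`. -/
def HasValueLaw (σ : Measure X) (P : Measure (Configuration X)) (u : Configuration X → X → ℝ)
    (ν : Measure ℝ) : Prop :=
  ∀ᵐ ω ∂P, ∀ B : Set ℝ, MeasurableSet B → 0 ∉ B → σ {t | u ω t ∈ B} = ν B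

/-- For p outside S, the value at s p is read at ω ∪ s_S, a configuration that involves no point
outside S. Its law is almost surely ν, since adding points preserves null sets; Fubini over the
points outside S then gives independent factors. -/
theorem measure_boxEvent_eq_mul (hP : IsPoissonMeasure σ P)
    (hu : Measurable (Function.uncurry u)) {ν : Measure ℝ} (hν : HasValueLaw σ P u ν)
    {ι : Type*} [Fintype ι] [DecidableEq ι] {B : ι → Set ℝ} (hB : ∀ p, MeasurableSet (B p))
    (hB0 : ∀ p, 0 ∉ B p) (S : Finset ι) :
    (P.prod (Measure.pi fun _ => σ)) (boxEvent u B S) =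
      (P.prod (Measure.pi fun _ => σ)) (boxEvent u (fun p : S => B p) Finset.univ) *
        ∏ p : {p // p ∉ S}, ν (B p) := by
  have := hP.isProbabilityMeasure
  have hpi : MeasurePreserving
      (MeasurableEquiv.piEquivPiSubtypeProd (fun _ : ι => X) (fun p => p ∈ S))
      (Measure.pi fun _ => σ) ((Measure.pi fun _ : {p // p ∈ S} => σ).prod
        (Measure.pi fun _ : {p // p ∉ S} => σ)) := by
    convert measurePreserving_piEquivPiSubtypeProd (fun _ : ι => σ) (fun p => p ∈ S)
  have hmp := ((measurePreserving_prodAssoc P (Measure.pi fun _ : {p // p ∈ S} => σ)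
      (Measure.pi fun _ : {p // p ∉ S} => σ)).symm).comp
    ((MeasurePreserving.id P).prod hpi)
  let T : Set ((Configuration X × ({p // p ∈ S} → X)) × ({p // p ∉ S} → X)) :=
    {r | r.1 ∈ boxEvent u (fun p : S => B p) Finset.univ ∧
      ∀ p : {p // p ∉ S}, u (addPoints r.1.2 Finset.univ r.1.1) (r.2 p) ∈ B p}
  have hT : MeasurableSet T := by
    refine (measurable_fst (measurableSet_boxEvent hu (fun p : S => hB p) _)).inter ?_
    have hforall : {r : (Configuration X × ({p // p ∈ S} → X)) × ({p // p ∉ S} → X) |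
        ∀ p : {p // p ∉ S}, u (addPoints r.1.2 Finset.univ r.1.1) (r.2 p) ∈ B p} =
        ⋂ p : {p // p ∉ S}, {r | u (addPoints r.1.2 Finset.univ r.1.1) (r.2 p) ∈ B p} := by
      ext r; simp
    refine MeasurableSet.congr ?_ hforall.symm
    refine MeasurableSet.iInter fun p => ?_
    have : Measurable fun r : (Configuration X × ({p // p ∈ S} → X)) × ({p // p ∉ S} → X) =>
        u (addPoints r.1.2 Finset.univ r.1.1) (r.2 p) :=
      hu.comp (((measurable_addPoints Finset.univ).comp measurable_fst).prodMk
        ((measurable_pi_apply p).comp measurable_snd))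
    exact this (hB p)
  have hpre : boxEvent u B S = (MeasurableEquiv.prodAssoc.symm ∘ Prod.map id
      (MeasurableEquiv.piEquivPiSubtypeProd (fun _ : ι => X) (fun p => p ∈ S))) ⁻¹' T := by
    ext ⟨ω, s⟩
    have h1 : ∀ p : S, addPoints (fun i : S => s i) (Finset.univ.erase p) ω =
        addPoints s (S.erase p) ω := by
      intro p
      refine (addPoints_comp (Function.Embedding.subtype (· ∈ S)) s _ ω).trans ?_
      congr 1
      ext i; simp
    have h2 : addPoints (fun i : S => s i) Finset.univ ω = addPoints s S ω := by
      refine (addPoints_comp (Function.Embedding.subtype (· ∈ S)) s _ ω).trans ?_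
      congr 1
      ext i; simp
    change (∀ p, u (addPoints s (S.erase p) ω) (s p) ∈ B p) ↔
      (∀ p : S, u (addPoints (fun i : S => s i) (Finset.univ.erase p) ω) (s p) ∈ B p) ∧
        ∀ p : {p // p ∉ S}, u (addPoints (fun i : S => s i) Finset.univ ω) (s p) ∈ B p
    simp_rw [h1, h2]
    constructor
    · intro h
      refine ⟨fun p => h p, fun p => ?_⟩
      have := h p
      rwa [Finset.erase_eq_of_notMem p.2] at this
    · intro h p
      by_cases hp : p ∈ S
      · exact h.1 ⟨p, hp⟩
      · rw [Finset.erase_eq_of_notMem hp]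
        exact h.2 ⟨p, hp⟩
  rw [hpre, hmp.measure_preimage hT.nullMeasurableSet, Measure.prod_apply hT]
  have hgood := (hP.quasiMeasurePreserving_addPoints_fst
    (Finset.univ : Finset {p // p ∈ S})).ae hν
  have hS := measurableSet_boxEvent hu (fun p : S => hB p) (Finset.univ : Finset S)
  have hint : ∀ᵐ r ∂(P.prod (Measure.pi fun _ : {p // p ∈ S} => σ)),
      (Measure.pi fun _ : {p // p ∉ S} => σ) (Prod.mk r ⁻¹' T) =
        (boxEvent u (fun p : S => B p) Finset.univ).indicator
          (fun _ => ∏ p : {p // p ∉ S}, ν (B p)) r := by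
    filter_upwards [hgood] with r hr
    by_cases hrS : r ∈ boxEvent u (fun p : S => B p) Finset.univ
    · rw [Set.indicator_of_mem hrS]
      have : Prod.mk r ⁻¹' T = Set.univ.pi fun p : {p // p ∉ S} =>
          {t | u (addPoints r.2 Finset.univ r.1) t ∈ B p} := by
        ext b
        simp only [T, Set.mem_preimage, Set.mem_ofPred_eq, Set.mem_pi, Set.mem_univ, true_imp_iff]
        exact and_iff_right hrS
      rw [this, Measure.pi_pi]
      exact Finset.prod_congr rfl fun p _ => hr _ (hB p) (hB0 p)
    · rw [Set.indicator_of_notMem hrS]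
      have : Prod.mk r ⁻¹' T = ∅ := by
        ext b
        simp only [T, Set.mem_preimage, Set.mem_ofPred_eq, Set.mem_empty_iff_false, iff_false]
        exact fun h => hrS h.1
      rw [this, measure_empty]
  rw [lintegral_congr_ae hint, lintegral_indicator hS, setLIntegral_const, mul_comm]

/-- Extracts the one unknown term of a balanced identity; finiteness of m permits cancellation in
the extended nonnegative reals. -/
theorem eq_of_sum_eq_sum_of_card_eq {α : Type*} [DecidableEq α] {A C : Finset α} {a : α}
    {g : α → ℝ≥0∞} {m : ℝ≥0∞} (haA : a ∈ A) (haC : a ∉ C) (hcard : A.card = C.card)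
    (hm : m ≠ ∞) (hg : ∀ b, b ≠ a → g b = m) (hsum : ∑ b ∈ A, g b = ∑ b ∈ C, g b) : g a = m := by
  have h1 : ∑ b ∈ C, g b = C.card * m := by
    rw [Finset.sum_congr rfl fun b hb => hg b (fun h => haC (h ▸ hb)), Finset.sum_const,
      nsmul_eq_mul]
  have h2 : ∑ b ∈ A, g b = g a + (A.erase a).card * m := by
    rw [← Finset.add_sum_erase _ _ haA,
      Finset.sum_congr rfl fun b hb => hg b (Finset.ne_of_mem_erase hb), Finset.sum_const,
      nsmul_eq_mul]
  rw [h1, h2, ← hcard, ← Finset.card_erase_add_one haA, Nat.cast_add, Nat.cast_one, add_mul,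
    one_mul, add_comm] at hsum
  exact (ENNReal.add_right_inj (ENNReal.mul_ne_top (ENNReal.natCast_ne_top _) hm)).1 hsum

/-- Under the cyclic condition, the values of the process at `n` points have the
`n`-th factorial moment measure of a Poisson process with intensity `ν`. -/
theorem measure_boxEvent_univ (hP : IsPoissonMeasure σ P)
    (hu : Measurable (Function.uncurry u)) (hcyc : CyclicCondition σ P u)
    {ν : Measure ℝ} (hν : HasValueLaw σ P u ν) (n : ℕ) :
    ∀ (ι : Type) [Fintype ι] [DecidableEq ι] (B : ι → Set ℝ), Fintype.card ι = n →
      (∀ p, MeasurableSet (B p)) → (∀ p, 0 ∉ B p) → (∀ p, ν (B p) ≠ ∞) →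
      (P.prod (Measure.pi fun _ => σ)) (boxEvent u B Finset.univ) = ∏ p, ν (B p) := by
  induction n using Nat.strong_induction_on with
  | _ n ih =>
  intro ι _ _ B hn hB hB0 hBfin
  have := hP.isProbabilityMeasure
  rcases isEmpty_or_nonempty ι with hι | hι
  · have : boxEvent u B Finset.univ = (Set.univ : Set (Configuration X × (ι → X))) := by
      ext q
      simp [boxEvent]
    rw [this]
    simp [Measure.prod_apply]
  set J : Finset ι → ℝ≥0∞ := fun S => (P.prod (Measure.pi fun _ => σ)) (boxEvent u B S) with hJ
  -- The factor carried by S is the statement for fewer points, so the induction hypothesis applies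
  -- to it.
  have hproper : ∀ S, S ≠ Finset.univ → J S = ∏ p, ν (B p) := by
    intro S hS
    have hcard : Fintype.card S < n := by
      rw [Fintype.card_coe, ← hn]
      exact Finset.card_lt_univ_of_notMem (Classical.choose_spec
        (not_forall.1 fun h => hS (Finset.eq_univ_iff_forall.2 h)))
    rw [hJ]
    simp only
    rw [measure_boxEvent_eq_mul hP hu hν hB hB0 S,
      ih _ hcard S (fun p => B p) rfl (fun p => hB p) (fun p => hB0 p) (fun p => hBfin p)]
    convert Fintype.prod_subtype_mul_prod_subtype (fun p => p ∈ S) fun p => ν (B p)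
  -- The integrals agree because, for almost every q, the even and the odd S with q in the box event
  -- are equally many.
  have hsum : ∑ S with Even (Finset.card S), J S = ∑ S with ¬ Even (Finset.card S), J S := by
    have hm : ∀ S : Finset ι, J S = ∫⁻ q, (boxEvent u B S).indicator 1 q
        ∂(P.prod (Measure.pi fun _ => σ)) := fun S =>
      (lintegral_indicator_one (measurableSet_boxEvent hu hB S)).symm
    simp_rw [hm]
    rw [← lintegral_finsetSum _ fun S _ => measurable_one.indicator
      (measurableSet_boxEvent hu hB S), ← lintegral_finsetSum _ fun S _ =>
      measurable_one.indicator (measurableSet_boxEvent hu hB S)]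
    refine lintegral_congr_ae ?_
    filter_upwards [ae_isAcyclicNetwork hP hcyc B] with q hq
    classical
    have h := hq.card_even_eq_card_odd
    simp only [decide_eq_true_eq] at h
    simp only [Set.indicator_apply, Pi.one_apply, Finset.sum_boole, Finset.filter_filter]
    have h' : ∀ S, q ∈ boxEvent u B S ↔
        ∀ p, u (addPoints q.2 (S.erase p) q.1) (q.2 p) ∈ B p := fun S => Iff.rfl
    simp only [h']
    exact_mod_cast h
  -- The constantly true network is acyclic and counts all subsets by parity.
  have hcard : (Finset.univ.filter fun S : Finset ι => Even S.card).card =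
      (Finset.univ.filter fun S : Finset ι => ¬ Even S.card).card := by
    have h : IsAcyclicNetwork fun (_ : ι) (_ : Finset ι) => true :=
      ⟨fun _ _ => rfl, fun _ _ _ _ _ => ⟨0, rfl⟩⟩
    simpa using h.card_even_eq_card_odd
  have hfin : ∏ p, ν (B p) ≠ ∞ := ENNReal.prod_ne_top fun p _ => hBfin p
  by_cases hev : Even (Finset.univ : Finset ι).card
  · exact eq_of_sum_eq_sum_of_card_eq (g := J) (by simpa using hev) (by simpa using hev) hcard hfin
      hproper hsum
  · exact eq_of_sum_eq_sum_of_card_eq (g := J) (by simpa using hev) (by simpa using hev)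
      hcard.symm hfin hproper hsum.symm

end Box

end PoissonInvariance

/-! ### Symmetric sums and the multivariate Mecke formula -/

namespace PoissonInvariance

section SymmetricSums

variable {X : Type*}

open Classical in
/-- The `k`-th elementary symmetric sum of `w`. -/
noncomputable def symmSum (k : ℕ) (w : X → ℝ≥0∞) : ℝ≥0∞ :=
  ∑' α : Finset X, if α.card = k then ∏ t ∈ α, w t else 0

theorem symmSum_zero (w : X → ℝ≥0∞) : symmSum 0 w = 1 := by
  rw [symmSum, tsum_eq_single ∅]
  · simp
  · intro α hα
    simp [hα]

theorem tsum_symmSum (w : X → ℝ≥0∞) : ∑' k, symmSum k w = ∑' α : Finset X, ∏ t ∈ α, w t := by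
  unfold symmSum
  rw [ENNReal.tsum_comm]
  exact tsum_congr fun α => by simp

/-- Double counting of the pairs t ∈ β with β of size k + 1; cutting w off at t keeps t out of the
remaining set. -/
theorem succ_mul_symmSum_succ (k : ℕ) (w : X → ℝ≥0∞) :
    ((k + 1 : ℕ) : ℝ≥0∞) * symmSum (k + 1) w =
      ∑' t, w t * symmSum k (({t}ᶜ : Set X).indicator w) := by
  classical
  have h1 : ((k + 1 : ℕ) : ℝ≥0∞) * symmSum (k + 1) w =
      ∑' t, ∑' β : Finset X, if t ∈ β ∧ β.card = k + 1 then ∏ x ∈ β, w x else 0 := by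
    rw [symmSum, ← ENNReal.tsum_mul_left, ENNReal.tsum_comm]
    refine tsum_congr fun β => ?_
    by_cases hβ : β.card = k + 1
    · simp only [hβ, if_true, and_true]
      rw [tsum_eq_sum (s := β) (fun t ht => by simp [ht])]
      rw [Finset.sum_congr rfl fun t ht => if_pos ht, Finset.sum_const, hβ, nsmul_eq_mul]
    · simp [hβ]
  rw [h1]
  refine tsum_congr fun t => ?_
  let i : {α : Finset X // t ∉ α} → Finset X := fun α => insert t α.1
  have hi : Function.Injective i := by
    intro a b hab
    refine Subtype.ext ?_
    rw [← Finset.erase_insert a.2, ← Finset.erase_insert b.2]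
    exact congrArg (fun s => Finset.erase s t) hab
  rw [← hi.tsum_eq]
  · rw [symmSum, ← ENNReal.tsum_mul_left]
    have hj : Function.Injective (Subtype.val : {α : Finset X // t ∉ α} → Finset X) :=
      Subtype.val_injective
    rw [← hj.tsum_eq]
    · refine tsum_congr fun α => ?_
      have h2 : ∏ x ∈ α.1, ({t}ᶜ : Set X).indicator w x = ∏ x ∈ α.1, w x :=
        Finset.prod_congr rfl fun x hx => Set.indicator_of_mem
          (by rintro rfl; exact α.2 hx) _
      simp only [i, Finset.mem_insert_self, true_and, Finset.card_insert_of_notMem α.2,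
        Nat.add_right_cancel_iff, Finset.prod_insert α.2, h2, mul_ite, mul_zero]
    · intro α hα
      by_contra hcon
      have htα : t ∈ α := by
        by_contra h
        exact hcon ⟨⟨α, h⟩, rfl⟩
      refine hα ?_
      have : ∏ x ∈ α, ({t}ᶜ : Set X).indicator w x = 0 :=
        Finset.prod_eq_zero htα (Set.indicator_of_notMem (by simp) _)
      simp [this]
  · intro β hβ
    have htβ : t ∈ β := by
      by_contra h
      exact hβ (by simp [h])
    exact ⟨⟨β.erase t, Finset.notMem_erase t β⟩, Finset.insert_erase htβ⟩

/-- Expand ∏ (1 + (exp (y t) - 1)) over a finite set and pass to the limit along finite sets;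
nonnegativity makes everything monotone. -/
theorem tsum_prod_ofReal_exp_sub_one {y : X → ℝ} (hy0 : ∀ t, 0 ≤ y t) (hy : Summable y) :
    ∑' α : Finset X, ∏ t ∈ α, ENNReal.ofReal (Real.exp (y t) - 1) =
      ENNReal.ofReal (Real.exp (∑' t, y t)) := by
  classical
  rw [ENNReal.tsum_eq_iSup_sum' (fun F : Finset X => F.powerset) (fun t =>
    ⟨t.biUnion id, fun α hα => Finset.mem_powerset.2 (Finset.subset_biUnion_of_mem id hα)⟩)]
  have h1 : ∀ F : Finset X, ∑ α ∈ F.powerset, ∏ t ∈ α, ENNReal.ofReal (Real.exp (y t) - 1) =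
      ENNReal.ofReal (Real.exp (∑ t ∈ F, y t)) := by
    intro F
    rw [← Finset.prod_one_add, Real.exp_sum, ENNReal.ofReal_prod_of_nonneg
      fun t _ => (Real.exp_pos _).le]
    refine Finset.prod_congr rfl fun t _ => ?_
    rw [← ENNReal.ofReal_one, ← ENNReal.ofReal_add zero_le_one
      (by have := Real.one_le_exp (hy0 t); linarith)]
    congr 1; ring
  simp_rw [h1]
  have hmono : Monotone fun F : Finset X => ENNReal.ofReal (Real.exp (∑ t ∈ F, y t)) :=
    fun F F' hF => ENNReal.ofReal_le_ofReal (Real.exp_le_exp.2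
      (Finset.sum_le_sum_of_subset_of_nonneg hF fun t _ _ => hy0 t))
  refine tendsto_nhds_unique (tendsto_atTop_iSup hmono) ?_
  exact (ENNReal.continuous_ofReal.tendsto _).comp ((Real.continuous_exp.tendsto _).comp hy.hasSum)

end SymmetricSums

section FactorialSums

open PoissonInvariance.Configuration

variable {X : Type*} [MetricSpace X] [SigmaCompactSpace X] [MeasurableSpace X] [BorelSpace X]
  {σ : Measure X} [SigmaFinite σ] [IsFiniteMeasureOnCompacts σ] {P : Measure (Configuration X)}
  {u : Configuration X → X → ℝ}

/-- The sum of `G s (ω \ s)` over the `k`-tuples `s` of distinct points of `ω`. -/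
noncomputable def facSum : (k : ℕ) → ((Fin k → X) → Configuration X → ℝ≥0∞) →
    Configuration X → ℝ≥0∞
  | 0, G, ω => G (fun i => i.elim0) ω
  | k + 1, G, ω => ∫⁻ t, facSum k (fun s => G (Fin.cons t s)) (ω.erase t) ∂ω.toMeasure

theorem measurable_finCons (k : ℕ) :
    Measurable fun q : X × (Fin k → X) => (Fin.cons q.1 q.2 : Fin (k + 1) → X) := by
  refine measurable_pi_lambda _ fun i => ?_
  refine Fin.cases ?_ (fun j => ?_) i
  · simpa using measurable_fst
  · exact (measurable_pi_apply j).comp measurable_snd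

/-- The parameter space α is arbitrary because each recursion step turns the chosen point into a
further parameter. It shares the universe of X so that α × X is again admissible. -/
theorem measurable_facSum.{u} {X : Type u} [MetricSpace X] [SigmaCompactSpace X] [MeasurableSpace X]
    [BorelSpace X] (k : ℕ) : ∀ (α : Type u) [MeasurableSpace α]
    (G : α → (Fin k → X) → Configuration X → ℝ≥0∞),
    Measurable (fun q : α × (Fin k → X) × Configuration X => G q.1 q.2.1 q.2.2) →
    Measurable fun q : α × Configuration X => facSum k (G q.1) q.2 := by
  induction k with
  | zero =>
    intro α _ G hG
    exact hG.comp (measurable_fst.prodMk (measurable_const.prodMk measurable_snd))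
  | succ k ih =>
    intro α _ G hG
    have h1 := ih (α × X) (fun a s => G a.1 (Fin.cons a.2 s)) (by
      refine hG.comp ((measurable_fst.comp measurable_fst).prodMk
        (((measurable_finCons k).comp ((measurable_snd.comp measurable_fst).prodMk
          (measurable_fst.comp measurable_snd))).prodMk (measurable_snd.comp measurable_snd))))
    have h2 : Measurable fun r : (α × Configuration X) × X =>
        facSum k (fun s => G r.1.1 (Fin.cons r.2 s)) (r.1.2.erase r.2) :=
      h1.comp (((measurable_fst.comp measurable_fst).prodMk measurable_snd).prodMk
        (measurable_erase.comp ((measurable_snd.comp measurable_fst).prodMk measurable_snd)))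
    exact measurable_lintegral_toMeasure (G := fun (q : α × Configuration X) t =>
      facSum k (fun s => G q.1 (Fin.cons t s)) (q.2.erase t)) measurable_snd h2

theorem lintegral_pi_fin_succ (σ : Measure X) [SigmaFinite σ] (k : ℕ)
    {f : (Fin (k + 1) → X) → ℝ≥0∞} (hf : Measurable f) :
    ∫⁻ s, f s ∂(Measure.pi fun _ => σ) =
      ∫⁻ t, ∫⁻ s, f (Fin.cons t s) ∂(Measure.pi fun _ : Fin k => σ) ∂σ := by
  have h := (measurePreserving_piFinSuccAbove (fun _ : Fin (k + 1) => σ) 0).symm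
  rw [← h.lintegral_comp hf]
  refine (lintegral_prod _ (hf.comp h.measurable).aemeasurable).trans ?_
  simp [MeasurableEquiv.piFinSuccAbove, Fin.insertNthEquiv, Fin.insertNth_zero']

/-- The Mecke formula for `k` points. -/
theorem IsPoissonMeasure.lintegral_facSum (hP : IsPoissonMeasure σ P) (k : ℕ) :
    ∀ G : (Fin k → X) → Configuration X → ℝ≥0∞, Measurable (Function.uncurry G) →
    ∫⁻ ω, facSum k G ω ∂P = ∫⁻ ω, ∫⁻ s, G s ω ∂(Measure.pi fun _ => σ) ∂P := by
  have := hP.isProbabilityMeasure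
  induction k with
  | zero =>
    intro G hG
    refine lintegral_congr fun ω => ?_
    have h := lintegral_dirac' (fun a : Fin 0 => (isEmptyElim a : X))
      (f := fun s => G s ω) (hG.comp measurable_prodMk_right)
    rw [Measure.pi_of_empty, h]
    simp only [facSum]
    congr 1
  | succ k ih =>
    intro G hG
    have hG' : Measurable fun q : X × (Fin k → X) × Configuration X =>
        G (Fin.cons q.1 q.2.1) q.2.2 :=
      hG.comp (((measurable_finCons k).comp (measurable_fst.prodMk
        (measurable_fst.comp measurable_snd))).prodMk (measurable_snd.comp measurable_snd))
    have hmeas := measurable_facSum k X (fun t s => G (Fin.cons t s)) hG'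
    have h1 := hP.lintegral_lintegral_erase
      (G := fun q => facSum k (fun s => G (Fin.cons q.2 s)) q.1) (hmeas.comp measurable_swap)
    simp only [facSum]
    rw [h1, lintegral_lintegral_swap (f := fun ω t => facSum k (fun s => G (Fin.cons t s)) ω)
      (hmeas.comp measurable_swap).aemeasurable]
    have h2 : ∀ t, ∫⁻ ω, facSum k (fun s => G (Fin.cons t s)) ω ∂P =
        ∫⁻ ω, ∫⁻ s, G (Fin.cons t s) ω ∂(Measure.pi fun _ => σ) ∂P := fun t =>
      ih _ (hG'.comp measurable_prodMk_left)
    simp_rw [h2]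
    rw [lintegral_lintegral_swap]
    · refine lintegral_congr fun ω => ?_
      exact (lintegral_pi_fin_succ σ k (f := fun s => G s ω)
        (hG.comp measurable_prodMk_right)).symm
    · refine (Measurable.lintegral_prod_right' (f := fun r : (X × Configuration X) × (Fin k → X) =>
        G (Fin.cons r.1.1 r.2) r.1.2) ?_).aemeasurable
      exact hG'.comp ((measurable_fst.comp measurable_fst).prodMk
        (measurable_snd.prodMk (measurable_snd.comp measurable_fst)))

/-- `ω \ {s_1, …, s_k}`. -/
def Configuration.erasePoints {k : ℕ} (s : Fin k → X) (ω : Configuration X) : Configuration X :=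
  ⟨ω.points \ Set.range s, fun K hK =>
    (ω.2 K hK).subset (Set.inter_subset_inter_left K Set.sdiff_subset)⟩

/-- The constant c absorbs v t when the point t is split off, which lets the induction run with ω \
{t} in place of ω. The factorial counts the orderings of a k-element set. -/
theorem facSum_eq_mul_symmSum (v : X → ℝ≥0∞) (k : ℕ) :
    ∀ (ω : Configuration X) (c : ℝ≥0∞) (G : (Fin k → X) → Configuration X → ℝ≥0∞),
      (∀ s : Fin k → X, Function.Injective s → (∀ i, s i ∈ ω.points) →
        G s (ω.erasePoints s) = c * ∏ i, v (s i)) →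
      facSum k G ω = c * (k.factorial * symmSum k (ω.points.indicator v)) := by
  induction k with
  | zero =>
    intro ω c G h
    have h0 := h (fun i => i.elim0) (fun i => i.elim0) (fun i => i.elim0)
    have h1 : ω.erasePoints (fun i : Fin 0 => (i.elim0 : X)) = ω := by
      ext1
      change ω.points \ Set.range _ = ω.points
      simp
    rw [h1] at h0
    simp only [facSum, h0, symmSum_zero]
    simp
  | succ k ih =>
    intro ω c G h
    simp only [facSum]
    rw [lintegral_toMeasure]
    have hstep : ∀ t : ω.points, facSum k (fun s => G (Fin.cons (t : X) s)) (ω.erase (t : X)) =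
        (c * v t) * (k.factorial * symmSum k ((ω.erase (t : X)).points.indicator v)) := by
      intro t
      refine ih (ω.erase (t : X)) (c * v t) _ fun s hs hsω => ?_
      have hmem : ∀ i, s i ∈ ω.points ∧ s i ≠ t := fun i => hsω i
      have h1 := h (Fin.cons (t : X) s) (Fin.cons_injective_iff.2
        ⟨fun ⟨i, hi⟩ => (hmem i).2 hi, hs⟩) (fun i => by
          refine Fin.cases ?_ (fun j => ?_) i
          · simp
          · simpa using (hmem j).1)
      have h2 : (ω.erase (t : X)).erasePoints s = ω.erasePoints (Fin.cons (t : X) s) := by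
        ext1
        change (ω.points \ {(t : X)}) \ Set.range s = ω.points \ Set.range _
        rw [Fin.range_cons, Set.sdiff_sdiff, Set.singleton_union]
      rw [h2, h1, Fin.prod_univ_succ]
      simp [mul_assoc]
    simp_rw [hstep]
    rw [tsum_subtype ω.points (fun t => (c * v t) *
      (k.factorial * symmSum k ((ω.erase t).points.indicator v)))]
    have h3 : ∀ t, ω.points.indicator (fun t => (c * v t) *
        (k.factorial * symmSum k ((ω.erase t).points.indicator v))) t =
        (c * k.factorial) * (ω.points.indicator v t *
          symmSum k (({t}ᶜ : Set X).indicator (ω.points.indicator v))) := by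
      intro t
      have h4 : ({t}ᶜ : Set X).indicator (ω.points.indicator v) =
          (ω.erase t).points.indicator v := by
        rw [Set.indicator_indicator, points_erase, Set.sdiff_eq, Set.inter_comm]
      rw [h4]
      by_cases ht : t ∈ ω.points
      · simp only [Set.indicator_of_mem ht]; ring
      · simp only [Set.indicator_of_notMem ht]; simp
    simp_rw [h3]
    rw [ENNReal.tsum_mul_left, ← succ_mul_symmSum_succ, Nat.factorial_succ]
    push_cast
    ring

end FactorialSums

end PoissonInvariance

/-! ### The exponential formula -/

namespace PoissonInvariance

open PoissonInvariance.Configuration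

theorem lintegral_pi_prod_eq_pow {α : Type*} [MeasurableSpace α] (ν : Measure α) [SigmaFinite ν]
    {g : α → ℝ≥0∞} (hg : Measurable g) (k : ℕ) :
    ∫⁻ x, ∏ i : Fin k, g (x i) ∂(Measure.pi fun _ => ν) = (∫⁻ x, g x ∂ν) ^ k := by
  induction k with
  | zero => simp
  | succ k ih =>
    have h := (measurePreserving_piFinSuccAbove (fun _ : Fin (k + 1) => ν) 0)
    have hprod : Measurable fun x : Fin k → α => ∏ i, g (x i) :=
      Finset.measurable_prod _ fun i _ => hg.comp (measurable_pi_apply i)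
    have h2 := h.lintegral_comp (f := fun q : α × (Fin k → α) => g q.1 * ∏ i, g (q.2 i))
      ((hg.comp measurable_fst).mul (hprod.comp measurable_snd))
    rw [lintegral_prod_mul hg.aemeasurable hprod.aemeasurable, ih] at h2
    rw [pow_succ', ← h2]
    refine lintegral_congr fun x => ?_
    rw [Fin.prod_univ_succ]
    rfl

variable {X : Type*} [MetricSpace X] [SigmaCompactSpace X] [MeasurableSpace X] [BorelSpace X]
  {σ : Measure X} [SigmaFinite σ] [IsFiniteMeasureOnCompacts σ] {P : Measure (Configuration X)}
  {u : Configuration X → X → ℝ} {ν : Measure ℝ}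

/-- The exceptional null set does not depend on g. Vanishing of g at 0 is needed because the value
law ignores the value 0, which may be taken on a set of infinite measure. -/
theorem HasValueLaw.ae_lintegral (hν : HasValueLaw σ P u ν) (hν0 : ν {0} = 0)
    (hu : Measurable (Function.uncurry u)) :
    ∀ᵐ ω ∂P, ∀ g : ℝ → ℝ≥0∞, Measurable g → g 0 = 0 → ∫⁻ t, g (u ω t) ∂σ = ∫⁻ x, g x ∂ν := by
  filter_upwards [hν] with ω hω g hg hg0
  have huω : Measurable (u ω) := hu.comp measurable_prodMk_left
  have heq : (σ.map (u ω)).restrict {0}ᶜ = ν := by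
    ext B hB
    rw [Measure.restrict_apply hB, Measure.map_apply huω (hB.inter (measurableSet_singleton _).compl)]
    refine (hω _ (hB.inter (measurableSet_singleton _).compl) (by simp)).trans ?_
    exact measure_inter_conull (by rw [compl_compl]; exact hν0)
  rw [← heq, ← lintegral_indicator (measurableSet_singleton _).compl, ← lintegral_map hg huω]
  refine lintegral_congr fun x => ?_
  by_cases hx : x = 0
  · simp [hx, hg0]
  · simp [hx]

/-- The joint values of the process at `k` points of the configuration, seen from the reduced
configuration. -/
def jointValues (u : Configuration X → X → ℝ) (k : ℕ) (q : Configuration X × (Fin k → X)) :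
    Fin k → ℝ :=
  fun i => u (addPoints q.2 (Finset.univ.erase i) q.1) (q.2 i)

theorem measurable_jointValues (hu : Measurable (Function.uncurry u)) (k : ℕ) :
    Measurable (jointValues u k) :=
  measurable_pi_lambda _ fun i => measurable_addPoints_apply hu _ i

/-- Boxes with sides of finite ν-measure determine the product measure, and on them this is
`measure_boxEvent_univ`; sides are cut at 0, which ν does not charge. -/
theorem restrict_map_jointValues (hP : IsPoissonMeasure σ P)
    (hu : Measurable (Function.uncurry u)) (hcyc : CyclicCondition σ P u)
    (hν : HasValueLaw σ P u ν) [SigmaFinite ν] (hν0 : ν {0} = 0) (k : ℕ) :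
    ((P.prod (Measure.pi fun _ => σ)).map (jointValues u k)).restrict
      (Set.univ.pi fun _ => {0}ᶜ) = Measure.pi fun _ => ν := by
  symm
  refine Measure.pi_eq_generateFrom (C := fun _ => {B | MeasurableSet B ∧ ν B < ∞}) (fun _ => ?_)
    (fun _ => ?_) (fun _ => ?_) (fun s hs => ?_)
  · refine le_antisymm (MeasurableSpace.generateFrom_le fun B hB => hB.1) fun B hB => ?_
    have : B = ⋃ n, B ∩ spanningSets ν n := by
      rw [← Set.inter_iUnion, iUnion_spanningSets, Set.inter_univ]
    rw [this]
    exact MeasurableSet.iUnion fun n => MeasurableSpace.measurableSet_generateFrom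
      ⟨hB.inter (measurableSet_spanningSets ν n),
        (measure_mono Set.inter_subset_right).trans_lt (measure_spanningSets_lt_top ν n)⟩
  · rintro A ⟨hA, hA'⟩ B ⟨hB, -⟩ -
    exact ⟨hA.inter hB, (measure_mono Set.inter_subset_left).trans_lt hA'⟩
  · exact ⟨spanningSets ν, fun n => ⟨measurableSet_spanningSets ν n,
      measure_spanningSets_lt_top ν n⟩, measure_spanningSets_lt_top ν, iUnion_spanningSets ν⟩
  · have hs' : ∀ i, MeasurableSet (s i ∩ {0}ᶜ) := fun i =>
      (hs i).1.inter (measurableSet_singleton _).compl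
    rw [Measure.restrict_apply (MeasurableSet.univ_pi fun i => (hs i).1), ← Set.pi_inter_distrib,
      Measure.map_apply (measurable_jointValues hu k) (MeasurableSet.univ_pi hs')]
    have hbox : jointValues u k ⁻¹' (Set.univ.pi fun i => s i ∩ {0}ᶜ) =
        boxEvent u (fun i => s i ∩ {0}ᶜ) Finset.univ := by
      ext q
      simp only [Set.mem_preimage, Set.mem_pi, Set.mem_univ, true_imp_iff]
      rfl
    rw [hbox, measure_boxEvent_univ hP hu hcyc hν k (Fin k) _ (Fintype.card_fin k) hs'
      (fun i => by simp) (fun i => ((measure_mono Set.inter_subset_left).trans_lt (hs i).2).ne)]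
    exact Finset.prod_congr rfl fun i _ =>
      measure_inter_conull (by rw [compl_compl]; exact hν0)

theorem lintegral_prod_jointValues (hP : IsPoissonMeasure σ P)
    (hu : Measurable (Function.uncurry u)) (hcyc : CyclicCondition σ P u)
    (hν : HasValueLaw σ P u ν) [SigmaFinite ν] (hν0 : ν {0} = 0)
    {g : ℝ → ℝ≥0∞} (hg : Measurable g) (hg0 : g 0 = 0) (k : ℕ) :
    ∫⁻ q, ∏ i, g (jointValues u k q i) ∂(P.prod (Measure.pi fun _ => σ)) =
      (∫⁻ x, g x ∂ν) ^ k := by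
  have hprod : Measurable fun x : Fin k → ℝ => ∏ i, g (x i) :=
    Finset.measurable_prod _ fun i _ => hg.comp (measurable_pi_apply i)
  rw [← lintegral_pi_prod_eq_pow ν hg k, ← restrict_map_jointValues hP hu hcyc hν hν0 k,
    ← lintegral_indicator (MeasurableSet.univ_pi fun _ => (measurableSet_singleton _).compl),
    ← lintegral_map hprod (measurable_jointValues hu k)]
  refine lintegral_congr fun x => ?_
  by_cases hx : x ∈ Set.univ.pi fun _ : Fin k => ({0}ᶜ : Set ℝ)
  · rw [Set.indicator_of_mem hx]
  · rw [Set.indicator_of_notMem hx]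
    simp only [Set.mem_pi, Set.mem_univ, true_imp_iff, not_forall] at hx
    obtain ⟨i, hi⟩ := hx
    have : x i = 0 := by simpa using hi
    exact Finset.prod_eq_zero (Finset.mem_univ i) (by rw [this, hg0])

/-- The sum `∑_{t ∈ ω} g(u_t(ω \ {t}))`. -/
noncomputable def pointSum (u : Configuration X → X → ℝ) (g : ℝ → ℝ≥0∞) (ω : Configuration X) :
    ℝ≥0∞ :=
  ∫⁻ t, g (u (ω.erase t) t) ∂ω.toMeasure

theorem measurable_pointSum (hu : Measurable (Function.uncurry u)) {g : ℝ → ℝ≥0∞}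
    (hg : Measurable g) : Measurable (pointSum u g) :=
  measurable_lintegral_toMeasure (G := fun ω t => g (u (ω.erase t) t)) measurable_id
    (hg.comp (hu.comp measurable_erase_prodMk))

theorem lintegral_pointSum (hP : IsPoissonMeasure σ P)
    (hu : Measurable (Function.uncurry u)) (hν : HasValueLaw σ P u ν) (hν0 : ν {0} = 0)
    {g : ℝ → ℝ≥0∞} (hg : Measurable g) (hg0 : g 0 = 0) :
    ∫⁻ ω, pointSum u g ω ∂P = ∫⁻ x, g x ∂ν := by
  have := hP.isProbabilityMeasure
  unfold pointSum
  refine (hP.lintegral_lintegral_erase (G := fun q => g (u q.1 q.2)) (hg.comp hu)).trans ?_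
  have : ∀ᵐ ω ∂P, ∫⁻ t, g (u ω t) ∂σ = ∫⁻ x, g x ∂ν := by
    filter_upwards [hν.ae_lintegral hν0 hu] with ω hω
    exact hω g hg hg0
  rw [lintegral_congr_ae this]
  simp

theorem measurable_uncurry_prod_jointValues (hu : Measurable (Function.uncurry u))
    {g : ℝ → ℝ≥0∞} (hg : Measurable g) (k : ℕ) :
    Measurable (Function.uncurry fun (s : Fin k → X) (ω : Configuration X) =>
      ∏ i, g (jointValues u k (ω, s) i)) := by
  refine Finset.measurable_prod _ fun i _ => hg.comp ?_
  exact ((measurable_pi_apply i).comp (measurable_jointValues hu k)).comp measurable_swap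

/-- Removing k distinct points of ω and putting all but s i back leaves ω \ {s i}. Each joint value
is thus a function of s i alone, and the factorial sum becomes a symmetric sum. -/
theorem facSum_jointValues (g : ℝ → ℝ≥0∞) (k : ℕ) (ω : Configuration X) :
    facSum k (fun s ω' => ∏ i, g (jointValues u k (ω', s) i)) ω =
      k.factorial * symmSum k (ω.points.indicator fun t => g (u (ω.erase t) t)) := by
  rw [facSum_eq_mul_symmSum (fun t => g (u (ω.erase t) t)) k ω 1, one_mul]
  intro s hs hsω
  rw [one_mul]
  refine Finset.prod_congr rfl fun i _ => ?_
  have : addPoints s (Finset.univ.erase i) (ω.erasePoints s) = ω.erase (s i) := by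
    ext1
    change (ω.points \ Set.range s) ∪ s '' _ = ω.points \ {s i}
    ext x
    simp only [Set.mem_union, Set.mem_sdiff, Set.mem_range, not_exists, Set.mem_image,
      Finset.coe_erase, Finset.coe_univ, Set.mem_univ, true_and, Set.mem_singleton_iff]
    constructor
    · rintro (⟨hx, hx'⟩ | ⟨j, hj, rfl⟩)
      · exact ⟨hx, fun h => hx' i h.symm⟩
      · exact ⟨hsω j, fun h => hj (hs h)⟩
    · rintro ⟨hx, hx'⟩
      by_cases h : ∃ j, s j = x
      · obtain ⟨j, rfl⟩ := h
        exact Or.inr ⟨j, fun h => hx' (h ▸ rfl), rfl⟩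
      · exact Or.inl ⟨hx, fun j hj => h ⟨j, hj⟩⟩
  simp only [jointValues, this]

/-- Grouping finite sets by cardinality k, the expected symmetric sum is c^k / k! with c = ∫ g dν;
these add up to exp c. -/
theorem lintegral_tsum_prod (hP : IsPoissonMeasure σ P)
    (hu : Measurable (Function.uncurry u)) (hcyc : CyclicCondition σ P u)
    (hν : HasValueLaw σ P u ν) [SigmaFinite ν] (hν0 : ν {0} = 0)
    {g : ℝ → ℝ≥0∞} (hg : Measurable g) (hg0 : g 0 = 0) (hfin : ∫⁻ x, g x ∂ν ≠ ∞) :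
    ∫⁻ ω, ∑' α : Finset X, ∏ t ∈ α, (ω.points.indicator fun t => g (u (ω.erase t) t)) t ∂P =
      ENNReal.ofReal (Real.exp (∫⁻ x, g x ∂ν).toReal) := by
  have := hP.isProbabilityMeasure
  set c := ∫⁻ x, g x ∂ν with hc
  have hfac : ∀ k : ℕ, ((k.factorial : ℕ) : ℝ≥0∞) ≠ 0 := fun k => by
    exact_mod_cast k.factorial_ne_zero
  have hsymm : ∀ (k : ℕ) (ω : Configuration X),
      symmSum k (ω.points.indicator fun t => g (u (ω.erase t) t)) =
      ((k.factorial : ℕ) : ℝ≥0∞)⁻¹ *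
        facSum k (fun s ω' => ∏ i, g (jointValues u k (ω', s) i)) ω := by
    intro k ω
    rw [facSum_jointValues, ← mul_assoc, ENNReal.inv_mul_cancel (hfac k)
      (ENNReal.natCast_ne_top _), one_mul]
  have hmeas : ∀ k : ℕ, Measurable
      (facSum k (fun (s : Fin k → X) ω' => ∏ i, g (jointValues u k (ω', s) i))) := by
    intro k
    have h := measurable_facSum k PUnit
      (fun _ (s : Fin k → X) ω' => ∏ i, g (jointValues u k (ω', s) i))
      ((measurable_uncurry_prod_jointValues hu hg k).comp measurable_snd)
    exact h.comp (measurable_const (a := PUnit.unit) |>.prodMk measurable_id)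
  have hint : ∀ k : ℕ, ∫⁻ ω, facSum k
      (fun (s : Fin k → X) ω' => ∏ i, g (jointValues u k (ω', s) i)) ω ∂P = c ^ k := by
    intro k
    rw [hP.lintegral_facSum k _ (measurable_uncurry_prod_jointValues hu hg k), hc,
      ← lintegral_prod_jointValues hP hu hcyc hν hν0 hg hg0 k, lintegral_prod]
    exact (Finset.measurable_prod _ fun i _ => hg.comp
      ((measurable_pi_apply i).comp (measurable_jointValues hu k))).aemeasurable
  simp_rw [← tsum_symmSum, hsymm]
  rw [lintegral_tsum fun k => ((hmeas k).const_mul _).aemeasurable]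
  simp_rw [lintegral_const_mul _ (hmeas _), hint]
  rw [Real.exp_eq_exp_ℝ, NormedSpace.exp_eq_tsum_div, ENNReal.ofReal_tsum_of_nonneg
    (fun k => by positivity) (Real.summable_pow_div_factorial _)]
  refine tsum_congr fun k => ?_
  rw [ENNReal.ofReal_div_of_pos (by positivity), ENNReal.ofReal_pow ENNReal.toReal_nonneg,
    ENNReal.ofReal_toReal hfin, ENNReal.ofReal_natCast, div_eq_mul_inv, mul_comm]

/-- The exponential formula: `E exp(∑_{t ∈ ω} φ(u_t(ω \ {t}))) = exp(∫ (e^φ - 1) dν)`. -/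
theorem lintegral_exp_pointSum (hP : IsPoissonMeasure σ P)
    (hu : Measurable (Function.uncurry u)) (hcyc : CyclicCondition σ P u)
    (hν : HasValueLaw σ P u ν) [SigmaFinite ν] (hν0 : ν {0} = 0)
    {φ : ℝ → ℝ} (hφ : Measurable φ) (hφ0 : φ 0 = 0) (hφnn : ∀ x, 0 ≤ φ x)
    (hfin : ∫⁻ x, ENNReal.ofReal (Real.exp (φ x) - 1) ∂ν ≠ ∞) :
    ∫⁻ ω, ENNReal.ofReal (Real.exp (pointSum u (fun x => ENNReal.ofReal (φ x)) ω).toReal) ∂P =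
      ENNReal.ofReal (Real.exp (∫⁻ x, ENNReal.ofReal (Real.exp (φ x) - 1) ∂ν).toReal) := by
  have hg : Measurable fun x => ENNReal.ofReal (Real.exp (φ x) - 1) :=
    ENNReal.measurable_ofReal.comp ((Real.measurable_exp.comp hφ).sub_const 1)
  have hφ' : Measurable fun x => ENNReal.ofReal (φ x) := ENNReal.measurable_ofReal.comp hφ
  rw [← lintegral_tsum_prod hP hu hcyc hν hν0 hg (by simp [hφ0]) hfin]
  refine lintegral_congr_ae ?_
  -- Finiteness must be checked since `toReal` sends ∞ to 0; it follows from φ ≤ exp φ - 1 and the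
  -- formula for the mean.
  have hsumfin : ∀ᵐ ω ∂P, pointSum u (fun x => ENNReal.ofReal (φ x)) ω < ∞ := by
    refine ae_lt_top (measurable_pointSum hu hφ') ?_
    rw [lintegral_pointSum hP hu hν hν0 hφ' (by simp [hφ0])]
    refine ne_top_of_le_ne_top hfin (lintegral_mono fun x => ENNReal.ofReal_le_ofReal ?_)
    have := Real.add_one_le_exp (φ x)
    linarith
  filter_upwards [hsumfin] with ω hω
  set y : X → ℝ := ω.points.indicator fun t => φ (u (ω.erase t) t) with hy
  have hy0 : ∀ t, 0 ≤ y t := fun t => Set.indicator_nonneg (fun _ _ => hφnn _) t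
  have hsum : pointSum u (fun x => ENNReal.ofReal (φ x)) ω = ∑' t, ENNReal.ofReal (y t) := by
    rw [pointSum, lintegral_toMeasure, tsum_subtype ω.points
      (fun t => ENNReal.ofReal (φ (u (ω.erase t) t)))]
    refine tsum_congr fun t => ?_
    by_cases ht : t ∈ ω.points <;> simp [hy, ht]
  rw [hsum] at hω
  have hysum : Summable y := by
    have := ENNReal.summable_toReal hω.ne
    refine this.congr fun t => ?_
    rw [ENNReal.toReal_ofReal (hy0 t)]
  have hind : ∀ t, (ω.points.indicator fun t =>
      ENNReal.ofReal (Real.exp (φ (u (ω.erase t) t)) - 1)) t =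
      ENNReal.ofReal (Real.exp (y t) - 1) := by
    intro t
    by_cases ht : t ∈ ω.points <;> simp [hy, ht]
  simp_rw [hind]
  rw [tsum_prod_ofReal_exp_sub_one hy0 hysum, hsum, ENNReal.tsum_toReal_eq
    (fun t => ENNReal.ofReal_ne_top)]
  simp_rw [ENNReal.toReal_ofReal (hy0 _)]

end PoissonInvariance

/-! ### Laws determined by exponential moments -/

namespace PoissonInvariance

open Filter Topology

section LaplaceTransform

variable {Ω Ω' : Type*} {mΩ : MeasurableSpace Ω} {mΩ' : MeasurableSpace Ω'} {μ : Measure Ω}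
  {μ' : Measure Ω'} {Z : Ω → ℝ} {W : Ω' → ℝ}

theorem integrable_exp_iff_lintegral_ne_top (hZ : Measurable Z) (t : ℝ) :
    Integrable (fun ω => Real.exp (t * Z ω)) μ ↔
      ∫⁻ ω, ENNReal.ofReal (Real.exp (t * Z ω)) ∂μ ≠ ∞ := by
  have hm : AEStronglyMeasurable (fun ω => Real.exp (t * Z ω)) μ :=
    (Real.measurable_exp.comp (hZ.const_mul t)).aestronglyMeasurable
  rw [Integrable, and_iff_right hm,
    hasFiniteIntegral_iff_ofReal (ae_of_all _ fun _ => (Real.exp_pos _).le), lt_top_iff_ne_top]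

theorem mgf_eq_toReal_lintegral (hZ : Measurable Z) (t : ℝ) :
    mgf Z μ t = (∫⁻ ω, ENNReal.ofReal (Real.exp (t * Z ω)) ∂μ).toReal :=
  integral_eq_lintegral_of_nonneg_ae (ae_of_all _ fun _ => (Real.exp_pos _).le)
    (Real.measurable_exp.comp (hZ.const_mul t)).aestronglyMeasurable

/-- Two Laplace transforms that are finite on an open interval and agree on the right of one of its
points have the same holomorphic extension. -/
theorem complexMGF_eqOn_of_lintegral_exp_eq (hZ : Measurable Z) (hW : Measurable W) {I : Set ℝ}
    (hI : IsOpen I) (hconv : Convex ℝ I)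
    (hZI : ∀ t ∈ I, ∫⁻ ω, ENNReal.ofReal (Real.exp (t * Z ω)) ∂μ ≠ ∞)
    (hWI : ∀ t ∈ I, ∫⁻ ω, ENNReal.ofReal (Real.exp (t * W ω)) ∂μ' ≠ ∞) {t₀ : ℝ} (ht₀ : t₀ ∈ I)
    (heq : ∀ t, t₀ < t → ∫⁻ ω, ENNReal.ofReal (Real.exp (t * Z ω)) ∂μ =
      ∫⁻ ω, ENNReal.ofReal (Real.exp (t * W ω)) ∂μ') :
    Set.EqOn (complexMGF Z μ) (complexMGF W μ') {z | z.re ∈ I} := by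
  have hsubZ : I ⊆ interior (integrableExpSet Z μ) := interior_maximal
    (fun t ht => (integrable_exp_iff_lintegral_ne_top hZ t).2 (hZI t ht)) hI
  have hsubW : I ⊆ interior (integrableExpSet W μ') := interior_maximal
    (fun t ht => (integrable_exp_iff_lintegral_ne_top hW t).2 (hWI t ht)) hI
  have hX : AnalyticOnNhd ℂ (complexMGF Z μ) {z | z.re ∈ I} :=
    analyticOnNhd_complexMGF.mono fun z hz => hsubZ hz
  have hY : AnalyticOnNhd ℂ (complexMGF W μ') {z | z.re ∈ I} :=
    analyticOnNhd_complexMGF.mono fun z hz => hsubW hz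
  refine AnalyticOnNhd.eqOn_of_preconnected_of_frequently_eq hX hY
    (hconv.linear_preimage Complex.reLm).isPreconnected
    (z₀ := (t₀ : ℂ)) (by simpa using ht₀) ?_
  have h_real : ∃ᶠ x : ℝ in 𝓝[>] t₀, complexMGF Z μ x = complexMGF W μ' x := by
    refine Eventually.frequently ?_
    filter_upwards [self_mem_nhdsWithin] with x hx
    rw [complexMGF_ofReal, complexMGF_ofReal, mgf_eq_toReal_lintegral hZ,
      mgf_eq_toReal_lintegral hW, heq x hx]
  have htend : Tendsto (fun x : ℝ => (x : ℂ)) (𝓝[>] t₀) (𝓝[≠] (t₀ : ℂ)) := by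
    rw [tendsto_nhdsWithin_iff]
    refine ⟨(Complex.continuous_ofReal.tendsto t₀).mono_left nhdsWithin_le_nhds, ?_⟩
    filter_upwards [self_mem_nhdsWithin] with x hx
    simpa using (ne_of_gt hx : x ≠ t₀)
  exact htend.frequently h_real

theorem lintegral_exp_eq_of_lintegral_exp_eq (hZ : Measurable Z) (hW : Measurable W) {I : Set ℝ}
    (hI : IsOpen I) (hconv : Convex ℝ I)
    (hZI : ∀ t ∈ I, ∫⁻ ω, ENNReal.ofReal (Real.exp (t * Z ω)) ∂μ ≠ ∞)
    (hWI : ∀ t ∈ I, ∫⁻ ω, ENNReal.ofReal (Real.exp (t * W ω)) ∂μ' ≠ ∞) {t₀ : ℝ} (ht₀ : t₀ ∈ I)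
    (heq : ∀ t, t₀ < t → ∫⁻ ω, ENNReal.ofReal (Real.exp (t * Z ω)) ∂μ =
      ∫⁻ ω, ENNReal.ofReal (Real.exp (t * W ω)) ∂μ') {t : ℝ} (ht : t ∈ I) :
    ∫⁻ ω, ENNReal.ofReal (Real.exp (t * Z ω)) ∂μ =
      ∫⁻ ω, ENNReal.ofReal (Real.exp (t * W ω)) ∂μ' := by
  have h := complexMGF_eqOn_of_lintegral_exp_eq hZ hW hI hconv hZI hWI ht₀ heq
    (show ((t : ℝ) : ℂ) ∈ {z : ℂ | z.re ∈ I} by simpa using ht)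
  rw [complexMGF_ofReal, complexMGF_ofReal, mgf_eq_toReal_lintegral hZ,
    mgf_eq_toReal_lintegral hW] at h
  exact (ENNReal.toReal_eq_toReal_iff' (hZI t ht) (hWI t ht)).1 (by exact_mod_cast h)

/-- The holomorphic extensions agree on a vertical strip that contains the imaginary axis, where
they are the characteristic functions. -/
theorem map_eq_of_lintegral_exp_eq [IsFiniteMeasure μ] [IsFiniteMeasure μ'] (hZ : Measurable Z)
    (hW : Measurable W) {I : Set ℝ} (hI : IsOpen I) (hconv : Convex ℝ I) (h0 : (0 : ℝ) ∈ I)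
    (hZI : ∀ t ∈ I, ∫⁻ ω, ENNReal.ofReal (Real.exp (t * Z ω)) ∂μ ≠ ∞)
    (hWI : ∀ t ∈ I, ∫⁻ ω, ENNReal.ofReal (Real.exp (t * W ω)) ∂μ' ≠ ∞)
    (heq : ∀ t, 0 < t → ∫⁻ ω, ENNReal.ofReal (Real.exp (t * Z ω)) ∂μ =
      ∫⁻ ω, ENNReal.ofReal (Real.exp (t * W ω)) ∂μ') :
    μ.map Z = μ'.map W := by
  refine Measure.ext_of_charFun (funext fun t => ?_)
  rw [← complexMGF_mul_I hZ.aemeasurable, ← complexMGF_mul_I hW.aemeasurable]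
  exact complexMGF_eqOn_of_lintegral_exp_eq hZ hW hI hconv hZI hWI h0 heq (by simpa using h0)

theorem lintegral_exp_withDensity_exp {A B : Ω → ℝ} (hA : Measurable A) (hB : Measurable B)
    (a b : ℝ) :
    ∫⁻ ω, ENNReal.ofReal (Real.exp (b * B ω))
      ∂(μ.withDensity fun ω => ENNReal.ofReal (Real.exp (a * A ω))) =
    ∫⁻ ω, ENNReal.ofReal (Real.exp (a * A ω + b * B ω)) ∂μ := by
  rw [lintegral_withDensity_eq_lintegral_mul _ (by fun_prop) (by fun_prop)]
  refine lintegral_congr fun ω => ?_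
  rw [Pi.mul_apply, ← ENNReal.ofReal_mul (Real.exp_pos _).le, ← Real.exp_add]

/-- The exponential moments of nonnegative combinations of two nonnegative variables
determine the law of their difference. -/
theorem map_sub_eq_of_lintegral_exp_eq [IsProbabilityMeasure μ] [IsProbabilityMeasure μ']
    {Z₁ Z₂ : Ω → ℝ} {W₁ W₂ : Ω' → ℝ}
    (hZ₁ : Measurable Z₁) (hZ₂ : Measurable Z₂) (hW₁ : Measurable W₁) (hW₂ : Measurable W₂)
    (hZ₁0 : ∀ ω, 0 ≤ Z₁ ω) (hZ₂0 : ∀ ω, 0 ≤ Z₂ ω) (hW₁0 : ∀ ω, 0 ≤ W₁ ω) (hW₂0 : ∀ ω, 0 ≤ W₂ ω)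
    (hfin : ∀ a b : ℝ, 0 ≤ a → 0 ≤ b →
      ∫⁻ ω, ENNReal.ofReal (Real.exp (a * Z₁ ω + b * Z₂ ω)) ∂μ ≠ ∞)
    (heq : ∀ a b : ℝ, 0 ≤ a → 0 ≤ b →
      ∫⁻ ω, ENNReal.ofReal (Real.exp (a * Z₁ ω + b * Z₂ ω)) ∂μ =
        ∫⁻ ω, ENNReal.ofReal (Real.exp (a * W₁ ω + b * W₂ ω)) ∂μ') :
    μ.map (fun ω => Z₁ ω - Z₂ ω) = μ'.map (fun ω => W₁ ω - W₂ ω) := by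
  have hfin' : ∀ a b : ℝ, 0 ≤ a → 0 ≤ b →
      ∫⁻ ω, ENNReal.ofReal (Real.exp (a * W₁ ω + b * W₂ ω)) ∂μ' ≠ ∞ := fun a b ha hb => by
    rw [← heq a b ha hb]; exact hfin a b ha hb
  have hbound : ∀ (t x y : ℝ), 0 ≤ x → 0 ≤ y →
      Real.exp (t * (x - y)) ≤ Real.exp (|t| * x + |t| * y) := by
    intro t x y hx hy
    refine Real.exp_le_exp.2 ?_
    nlinarith [mul_le_mul_of_nonneg_right (le_abs_self t) hx,
      mul_le_mul_of_nonneg_right (neg_abs_le t) hy]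
  refine map_eq_of_lintegral_exp_eq (hZ₁.sub hZ₂) (hW₁.sub hW₂) isOpen_univ convex_univ
    (Set.mem_univ _) (fun t _ => ?_) (fun t _ => ?_) (fun a ha => ?_)
  · exact ne_top_of_le_ne_top (hfin |t| |t| (abs_nonneg t) (abs_nonneg t))
      (lintegral_mono fun ω => ENNReal.ofReal_le_ofReal (hbound t _ _ (hZ₁0 ω) (hZ₂0 ω)))
  · exact ne_top_of_le_ne_top (hfin' |t| |t| (abs_nonneg t) (abs_nonneg t))
      (lintegral_mono fun ω => ENNReal.ofReal_le_ofReal (hbound t _ _ (hW₁0 ω) (hW₂0 ω)))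
  have hmax : ∀ b x : ℝ, 0 ≤ x → b * x ≤ |b| * x := fun b x hx =>
    mul_le_mul_of_nonneg_right (le_abs_self b) hx
  -- For fixed a > 0, tilt both measures by exp (a Z₁) and exp (a W₁). The identity in b, known for
  -- b > 0, continues analytically to b = -a, where it concerns the differences.
  have h := lintegral_exp_eq_of_lintegral_exp_eq
    (μ := μ.withDensity fun ω => ENNReal.ofReal (Real.exp (a * Z₁ ω)))
    (μ' := μ'.withDensity fun ω => ENNReal.ofReal (Real.exp (a * W₁ ω))) hZ₂ hW₂
    isOpen_univ convex_univ (fun b _ => ?_) (fun b _ => ?_) (Set.mem_univ 0) (fun b hb => ?_)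
    (Set.mem_univ (-a))
  · rw [lintegral_exp_withDensity_exp hZ₁ hZ₂, lintegral_exp_withDensity_exp hW₁ hW₂] at h
    convert h using 6 <;> ring
  · rw [lintegral_exp_withDensity_exp hZ₁ hZ₂]
    exact ne_top_of_le_ne_top (hfin a |b| ha.le (abs_nonneg b)) (lintegral_mono fun ω =>
      ENNReal.ofReal_le_ofReal (Real.exp_le_exp.2 (by linarith [hmax b _ (hZ₂0 ω)])))
  · rw [lintegral_exp_withDensity_exp hW₁ hW₂]
    exact ne_top_of_le_ne_top (hfin' a |b| ha.le (abs_nonneg b)) (lintegral_mono fun ω =>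
      ENNReal.ofReal_le_ofReal (Real.exp_le_exp.2 (by linarith [hmax b _ (hW₂0 ω)])))
  · rw [lintegral_exp_withDensity_exp hZ₁ hZ₂, lintegral_exp_withDensity_exp hW₁ hW₂]
    exact heq a b ha.le hb.le

end LaplaceTransform

/-! ### Functions with equal p-norms -/

section Equimeasurable

variable {X Y : Type*} {mX : MeasurableSpace X} {mY : MeasurableSpace Y} {σ : Measure X}
  {μ : Measure Y} {F : X → ℝ} {f : Y → ℝ}

/-- The weight F² removes the set F = 0 and makes log F have p-norms as its exponential moments,
with p = t + 2. The range p > 1 becomes t > -1, an open interval around 0; with weight F, the point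
t = 0 would be the endpoint p = 1. -/
theorem lintegral_exp_log_withDensity_sq (hF : Measurable F) (hF0 : ∀ x, 0 ≤ F x) {t : ℝ}
    (ht : -2 < t) :
    ∫⁻ x, ENNReal.ofReal (Real.exp (t * Real.log (F x)))
      ∂(σ.withDensity fun x => ENNReal.ofReal (F x ^ 2)) = ∫⁻ x, ‖F x‖ₑ ^ (t + 2) ∂σ := by
  rw [lintegral_withDensity_eq_lintegral_mul _ (by fun_prop) (by fun_prop)]
  refine lintegral_congr fun x => ?_
  rw [Pi.mul_apply, ← ENNReal.ofReal_mul (by positivity), Real.enorm_of_nonneg (hF0 x)]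
  rcases (hF0 x).eq_or_lt with h | h
  · rw [← h]
    simp [ENNReal.zero_rpow_of_pos (by linarith : 0 < t + 2)]
  · rw [ENNReal.ofReal_rpow_of_pos h]
    congr 1
    rw [mul_comm t, ← Real.rpow_def_of_pos h, Real.rpow_add h, mul_comm]
    norm_num

/-- The factor exp (-2 y) at y = log F undoes the weight F², recovering σ from the law of log F. -/
theorem measure_preimage_eq_lintegral_log (hF : Measurable F) (hF0 : ∀ x, 0 ≤ F x) {D : Set ℝ}
    (hD : MeasurableSet D) (hD0 : D ⊆ Set.Ioi 0) :
    σ {x | F x ∈ D} = ∫⁻ y, (Real.exp ⁻¹' D).indicator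
      (fun y => ENNReal.ofReal (Real.exp (-2 * y))) y
      ∂((σ.withDensity fun x => ENNReal.ofReal (F x ^ 2)).map fun x => Real.log (F x)) := by
  have hD' : MeasurableSet (Real.exp ⁻¹' D) := Real.measurable_exp hD
  have hm : Measurable ((Real.exp ⁻¹' D).indicator
      (fun y => ENNReal.ofReal (Real.exp (-2 * y)))) :=
    Measurable.indicator (by fun_prop) hD'
  have hm' : Measurable fun x => (Real.exp ⁻¹' D).indicator
      (fun y => ENNReal.ofReal (Real.exp (-2 * y))) (Real.log (F x)) := hm.comp (by fun_prop)
  rw [lintegral_map hm (by fun_prop), lintegral_withDensity_eq_lintegral_mul _ (by fun_prop) hm']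
  refine (lintegral_indicator_one (hF hD)).symm.trans (lintegral_congr fun x => ?_)
  rw [Pi.mul_apply]
  rcases (hF0 x).eq_or_lt with h | h
  · rw [← h]
    have : x ∉ F ⁻¹' D := fun hx => by
      have h2 := hD0 hx
      rw [← h] at h2
      exact lt_irrefl (0 : ℝ) (Set.mem_Ioi.1 h2)
    rw [Set.indicator_of_notMem this]
    simp
  · by_cases hx : F x ∈ D
    · have h1 : x ∈ F ⁻¹' D := hx
      have h2 : Real.log (F x) ∈ Real.exp ⁻¹' D := by
        rw [Set.mem_preimage, Real.exp_log h]; exact hx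
      rw [Set.indicator_of_mem h1, Set.indicator_of_mem h2, ← ENNReal.ofReal_mul (by positivity),
        Pi.one_apply, ← ENNReal.ofReal_one]
      congr 1
      rw [mul_comm (-2 : ℝ), ← Real.rpow_def_of_pos h, ← Real.rpow_natCast, ← Real.rpow_add h]
      norm_num
    · have h1 : x ∉ F ⁻¹' D := hx
      have h2 : Real.log (F x) ∉ Real.exp ⁻¹' D := by
        rw [Set.mem_preimage, Real.exp_log h]; exact hx
      rw [Set.indicator_of_notMem h1, Set.indicator_of_notMem h2, mul_zero]

theorem lintegral_enorm_rpow_eq (ρ : Measure X) (g : X → ℝ) {p : ℝ≥0} (hp : 1 ≤ p) :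
    ∫⁻ x, ‖g x‖ₑ ^ (p : ℝ) ∂ρ = eLpNorm g p ρ ^ (p : ℝ) := by
  have hp0 : p ≠ 0 := (zero_lt_one.trans_le hp).ne'
  rw [eLpNorm_eq_lintegral_rpow_enorm_toReal (by simpa using hp0) ENNReal.coe_ne_top,
    ENNReal.coe_toReal, one_div, ENNReal.rpow_inv_rpow (by exact_mod_cast hp0)]

/-- Nonnegative functions with the same `p`-norms for all `p ∈ [1, ∞)` have the same law on
`(0, ∞)`. -/
theorem measure_preimage_eq_of_eLpNorm_eq (hF : Measurable F) (hF0 : ∀ x, 0 ≤ F x)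
    (hf : Measurable f) (hf0 : ∀ y, 0 ≤ f y)
    (hfin : ∀ p : ℝ≥0, 1 ≤ p → eLpNorm f p μ ≠ ∞)
    (heq : ∀ p : ℝ≥0, 1 ≤ p → eLpNorm F p σ = eLpNorm f p μ) {D : Set ℝ}
    (hD : MeasurableSet D) (hD0 : D ⊆ Set.Ioi 0) :
    σ {x | F x ∈ D} = μ {y | f y ∈ D} := by
  have key : ∀ t : ℝ, -1 < t → ∫⁻ x, ‖F x‖ₑ ^ (t + 2) ∂σ = ∫⁻ y, ‖f y‖ₑ ^ (t + 2) ∂μ ∧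
      ∫⁻ y, ‖f y‖ₑ ^ (t + 2) ∂μ ≠ ∞ := by
    intro t ht
    have h1 : (1 : ℝ≥0) ≤ (t + 2).toNNReal := by
      rw [Real.le_toNNReal_iff_coe_le (by linarith)]
      simp only [NNReal.coe_one]; linarith
    have h2 := lintegral_enorm_rpow_eq σ F h1
    have h3 := lintegral_enorm_rpow_eq μ f h1
    rw [Real.coe_toNNReal _ (by linarith)] at h2 h3
    rw [h2, h3, heq _ h1]
    exact ⟨rfl, ENNReal.rpow_ne_top_of_nonneg (by linarith) (hfin _ h1)⟩
  have hmass : (σ.withDensity fun x => ENNReal.ofReal (F x ^ 2)) Set.univ ≠ ∞ := by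
    have h := lintegral_exp_log_withDensity_sq (σ := σ) hF hF0 (t := 0) (by norm_num)
    simp only [zero_mul, Real.exp_zero, ENNReal.ofReal_one, lintegral_one] at h
    rw [h, (key 0 (by norm_num)).1]
    exact (key 0 (by norm_num)).2
  have hmass' : (μ.withDensity fun x => ENNReal.ofReal (f x ^ 2)) Set.univ ≠ ∞ := by
    have h := lintegral_exp_log_withDensity_sq (σ := μ) hf hf0 (t := 0) (by norm_num)
    simp only [zero_mul, Real.exp_zero, ENNReal.ofReal_one, lintegral_one] at h
    rw [h]
    exact (key 0 (by norm_num)).2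
  have : IsFiniteMeasure (σ.withDensity fun x => ENNReal.ofReal (F x ^ 2)) := ⟨hmass.lt_top⟩
  have : IsFiniteMeasure (μ.withDensity fun x => ENNReal.ofReal (f x ^ 2)) := ⟨hmass'.lt_top⟩
  rw [measure_preimage_eq_lintegral_log hF hF0 hD hD0,
    measure_preimage_eq_lintegral_log hf hf0 hD hD0]
  congr 1
  refine map_eq_of_lintegral_exp_eq (I := Set.Ioi (-1)) (by fun_prop) (by fun_prop) isOpen_Ioi
    (convex_Ioi _) (by norm_num) (fun t ht => ?_) (fun t ht => ?_) (fun t ht => ?_)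
  · have ht' : -1 < t := ht
    rw [lintegral_exp_log_withDensity_sq hF hF0 (by linarith), (key t ht').1]
    exact (key t ht').2
  · have ht' : -1 < t := ht
    rw [lintegral_exp_log_withDensity_sq hf hf0 (by linarith)]
    exact (key t ht').2
  · rw [lintegral_exp_log_withDensity_sq hF hF0 (by linarith),
      lintegral_exp_log_withDensity_sq hf hf0 (by linarith), (key t (by linarith)).1]

end Equimeasurable

end PoissonInvariance

/-! ### Random isometries preserve distributions -/

namespace PoissonInvariance

section Isometry

variable {X Y : Type*} [TopologicalSpace X] [MeasurableSpace X] [MeasurableSpace Y]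
  {σ : Measure X} {μ : Measure Y} {R : Configuration X → (Y →ₘ[μ] ℝ) → (X →ₘ[σ] ℝ)}

theorem IsRandomIsometry.ae_nonneg (hR : IsRandomIsometry σ μ R) (ω : Configuration X)
    {f : Y → ℝ} (hf : AEStronglyMeasurable f μ) (hf0 : ∀ y, 0 ≤ f y) (hmem : MemLp f 1 μ) :
    ∀ᵐ t ∂σ, 0 ≤ R ω (AEEqFun.mk f hf) t := by
  have h := hR.nonneg ω 1 le_rfl (AEEqFun.mk f hf) (Lp.mem_Lp_iff_memLp.2
    (hmem.ae_eq (AEEqFun.coeFn_mk f hf).symm)) (by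
      rw [← AEEqFun.coeFn_le]
      filter_upwards [AEEqFun.coeFn_mk f hf, AEEqFun.coeFn_zero (μ := μ) (β := ℝ)] with y h1 h2
      rw [h1, h2]; exact hf0 y)
  rw [← AEEqFun.coeFn_le] at h
  filter_upwards [h, AEEqFun.coeFn_zero (μ := σ) (β := ℝ)] with t h1 h2
  rwa [h2] at h1

theorem IsRandomIsometry.eLpNorm_mk (hR : IsRandomIsometry σ μ R) (ω : Configuration X)
    {f : Y → ℝ} (hf : AEStronglyMeasurable f μ) {p : ℝ≥0} (hp : 1 ≤ p) (hmem : MemLp f p μ) :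
    eLpNorm (R ω (AEEqFun.mk f hf)) p σ = eLpNorm f p μ := by
  rw [hR.eLpNorm_map ω p (by exact_mod_cast hp) _ (Lp.mem_Lp_iff_memLp.2
    (hmem.ae_eq (AEEqFun.coeFn_mk f hf).symm))]
  exact eLpNorm_congr_ae (AEEqFun.coeFn_mk f hf)

theorem IsRandomIsometry.measure_preimage_eq_of_nonneg (hR : IsRandomIsometry σ μ R)
    (ω : Configuration X) {f : Y → ℝ} (hf : Measurable f) (hf0 : ∀ y, 0 ≤ f y)
    (hmem : ∀ p : ℝ≥0, 1 ≤ p → MemLp f p μ) {D : Set ℝ} (hD : MeasurableSet D)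
    (hD0 : D ⊆ Set.Ioi 0) :
    σ {t | R ω (AEEqFun.mk f hf.aestronglyMeasurable) t ∈ D} = μ {y | f y ∈ D} := by
  set A := R ω (AEEqFun.mk f hf.aestronglyMeasurable) with hA
  have hA0 : ∀ᵐ t ∂σ, 0 ≤ A t := hR.ae_nonneg ω _ hf0 (hmem 1 le_rfl)
  -- The image is only almost everywhere nonnegative; truncation gives a version to which the result
  -- on p-norms applies.
  have hAF : (fun t => max (A t) 0) =ᵐ[σ] A := by
    filter_upwards [hA0] with t ht using max_eq_left ht
  rw [← measure_preimage_eq_of_eLpNorm_eq (A.measurable.max measurable_const)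
    (fun t => le_max_right _ _) hf hf0 (fun p hp => (hmem p hp).2.ne)
    (fun p hp => (eLpNorm_congr_ae hAF).trans (hR.eLpNorm_mk ω _ hp (hmem p hp))) hD hD0]
  refine measure_congr (Filter.eventuallyEq_set.2 ?_)
  filter_upwards [hAF] with t ht
  rw [ht]

/-- Let A, B ≥ 0 be the images of the two parts. Since h and |h| have the same L¹ norm, so do A - B
and A + B; as |A - B| ≤ A + B, equality holds almost everywhere, which forces A = 0 or B = 0. -/
theorem IsRandomIsometry.ae_eq_posPart_sub_negPart (hR : IsRandomIsometry σ μ R)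
    (ω : Configuration X) {h : Y → ℝ} (hh : Measurable h) (hmem : MemLp h 1 μ) :
    ∀ᵐ t ∂σ, R ω (AEEqFun.mk h hh.aestronglyMeasurable) t =
        R ω (AEEqFun.mk (fun y => max (h y) 0) (hh.max measurable_const).aestronglyMeasurable) t -
        R ω (AEEqFun.mk (fun y => max (-h y) 0)
          (hh.neg.max measurable_const).aestronglyMeasurable) t ∧
      (R ω (AEEqFun.mk (fun y => max (h y) 0)
          (hh.max measurable_const).aestronglyMeasurable) t = 0 ∨
        R ω (AEEqFun.mk (fun y => max (-h y) 0)
          (hh.neg.max measurable_const).aestronglyMeasurable) t = 0) := by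
  have hmp : MemLp (fun y => max (h y) 0) 1 μ := hmem.pos_part
  have hmn : MemLp (fun y => max (-h y) 0) 1 μ := hmem.neg_part
  have hmabs : MemLp (fun y => |h y|) 1 μ := hmem.abs
  set hp := AEEqFun.mk (fun y => max (h y) 0) (hh.max measurable_const).aestronglyMeasurable
    (μ := μ) with hhp
  set hn := AEEqFun.mk (fun y => max (-h y) 0) (hh.neg.max measurable_const).aestronglyMeasurable
    (μ := μ) with hhn
  have hpm : hp ∈ Lp ℝ 1 μ := Lp.mem_Lp_iff_memLp.2 (hmp.ae_eq (AEEqFun.coeFn_mk _ _).symm)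
  have hnm : hn ∈ Lp ℝ 1 μ := Lp.mem_Lp_iff_memLp.2 (hmn.ae_eq (AEEqFun.coeFn_mk _ _).symm)
  have e1 : AEEqFun.mk h hh.aestronglyMeasurable = hp + (-1 : ℝ) • hn := by
    rw [hhp, hhn, AEEqFun.smul_mk, AEEqFun.mk_add_mk, AEEqFun.mk_eq_mk]
    refine Filter.Eventually.of_forall fun y => ?_
    simp only [Pi.add_apply, Pi.smul_apply, smul_eq_mul]
    rcases le_total (h y) 0 with h0 | h0
    · rw [max_eq_right h0, max_eq_left (by linarith)]; ring
    · rw [max_eq_left h0, max_eq_right (by linarith)]; ring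
  have e2 : AEEqFun.mk (fun y => |h y|) hh.abs.aestronglyMeasurable = hp + hn := by
    rw [hhp, hhn, AEEqFun.mk_add_mk, AEEqFun.mk_eq_mk]
    refine Filter.Eventually.of_forall fun y => ?_
    simp only [Pi.add_apply]
    rcases le_total (h y) 0 with h0 | h0
    · rw [max_eq_right h0, max_eq_left (by linarith), abs_of_nonpos h0]; ring
    · rw [max_eq_left h0, max_eq_right (by linarith), abs_of_nonneg h0]; ring
  have r1 : R ω (AEEqFun.mk h hh.aestronglyMeasurable) = R ω hp + (-1 : ℝ) • R ω hn := by
    rw [e1, hR.map_add ω 1 le_rfl _ hpm _ (Lp.const_smul_mem_Lp (-1 : ℝ) ⟨hn, hnm⟩),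
      hR.map_smul ω 1 le_rfl _ _ hnm]
  have r2 : R ω (AEEqFun.mk (fun y => |h y|) hh.abs.aestronglyMeasurable) = R ω hp + R ω hn := by
    rw [e2, hR.map_add ω 1 le_rfl _ hpm _ hnm]
  have c1 : ∀ᵐ t ∂σ, R ω (AEEqFun.mk h hh.aestronglyMeasurable) t = R ω hp t - R ω hn t := by
    filter_upwards [AEEqFun.coeFn_add (R ω hp) ((-1 : ℝ) • R ω hn),
      AEEqFun.coeFn_smul (-1 : ℝ) (R ω hn)] with t h1 h2
    rw [r1, h1, Pi.add_apply, h2]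
    simp [sub_eq_add_neg]
  have c2 : ∀ᵐ t ∂σ, R ω (AEEqFun.mk (fun y => |h y|) hh.abs.aestronglyMeasurable) t =
      R ω hp t + R ω hn t := by
    filter_upwards [AEEqFun.coeFn_add (R ω hp) (R ω hn)] with t h1
    rw [r2, h1, Pi.add_apply]
  have p0 : ∀ᵐ t ∂σ, 0 ≤ R ω hp t := hR.ae_nonneg ω _ (fun y => le_max_right _ _) hmp
  have n0 : ∀ᵐ t ∂σ, 0 ≤ R ω hn t := hR.ae_nonneg ω _ (fun y => le_max_right _ _) hmn
  have hnorm : ∫⁻ t, ‖R ω hp t - R ω hn t‖ₑ ∂σ = ∫⁻ t, ‖R ω hp t + R ω hn t‖ₑ ∂σ := by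
    have i1 := hR.eLpNorm_mk ω hh.aestronglyMeasurable le_rfl hmem
    have i2 := hR.eLpNorm_mk ω hh.abs.aestronglyMeasurable le_rfl hmabs
    rw [eLpNorm_congr_ae c1, ENNReal.coe_one, eLpNorm_one_eq_lintegral_enorm] at i1
    rw [eLpNorm_congr_ae c2, ENNReal.coe_one, eLpNorm_one_eq_lintegral_enorm] at i2
    rw [i1, i2, eLpNorm_one_eq_lintegral_enorm, eLpNorm_one_eq_lintegral_enorm]
    simp
  have hfin : ∫⁻ t, ‖R ω hp t - R ω hn t‖ₑ ∂σ ≠ ∞ := by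
    have i1 := hR.eLpNorm_mk ω hh.aestronglyMeasurable le_rfl hmem
    rw [eLpNorm_congr_ae c1, ENNReal.coe_one, eLpNorm_one_eq_lintegral_enorm] at i1
    rw [i1]; exact hmem.2.ne
  have hle : (fun t => ‖R ω hp t - R ω hn t‖ₑ) ≤ᵐ[σ] fun t => ‖R ω hp t + R ω hn t‖ₑ := by
    filter_upwards [p0, n0] with t h1 h2
    rw [enorm_le_iff_norm_le, Real.norm_eq_abs, Real.norm_eq_abs, abs_le]
    rw [abs_of_nonneg (by linarith)]
    constructor <;> linarith
  have hae := ae_eq_of_ae_le_of_lintegral_le hle hfin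
    ((R ω hp).measurable.add (R ω hn).measurable).enorm.aemeasurable hnorm.symm.le
  filter_upwards [c1, hae, p0, n0] with t t1 t2 t3 t4
  refine ⟨t1, ?_⟩
  have t5 : |R ω hp t - R ω hn t| = |R ω hp t + R ω hn t| := by
    have := congrArg ENNReal.toReal t2
    simpa using this
  rw [abs_of_nonneg (by linarith : 0 ≤ R ω hp t + R ω hn t)] at t5
  rcases abs_cases (R ω hp t - R ω hn t) with h | h
  · right; linarith
  · left; linarith

/-- A positivity preserving isometry of all `L^p` spaces preserves the distribution of a function
away from zero. -/
theorem IsRandomIsometry.measure_preimage_eq (hR : IsRandomIsometry σ μ R) (ω : Configuration X)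
    {h : Y → ℝ} (hh : Measurable h) (hmem : ∀ p : ℝ≥0, 1 ≤ p → MemLp h p μ) {D : Set ℝ}
    (hD : MeasurableSet D) (hD0 : 0 ∉ D) :
    σ {t | R ω (AEEqFun.mk h hh.aestronglyMeasurable) t ∈ D} = μ {y | h y ∈ D} := by
  set H := R ω (AEEqFun.mk h hh.aestronglyMeasurable) with hH
  have hdecomp := hR.ae_eq_posPart_sub_negPart ω hh (hmem 1 le_rfl)
  have p0 := hR.ae_nonneg ω (hh.max measurable_const).aestronglyMeasurable
    (fun y => le_max_right (h y) 0) (hmem 1 le_rfl).pos_part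
  have n0 := hR.ae_nonneg ω (f := fun y => max (-h y) 0)
    (hh.neg.max measurable_const).aestronglyMeasurable (fun y => le_max_right (-h y) 0) (hmem 1 le_rfl).neg_part
  have hpos := hR.measure_preimage_eq_of_nonneg ω (hh.max measurable_const)
    (fun y => le_max_right (h y) 0) (fun p hp => (hmem p hp).pos_part)
    (hD.inter measurableSet_Ioi) (Set.inter_subset_right (s := D) (t := Set.Ioi 0))
  have hneg := hR.measure_preimage_eq_of_nonneg ω (f := fun y => max (-h y) 0)
    (hh.neg.max measurable_const) (fun y => le_max_right (-h y) 0) (fun p hp => (hmem p hp).neg_part)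
    ((measurable_neg hD).inter measurableSet_Ioi)
    (Set.inter_subset_right (s := Neg.neg ⁻¹' D) (t := Set.Ioi 0))
  rw [← measure_inter_add_sdiff {t | H t ∈ D} (measurableSet_lt measurable_const H.measurable :
      MeasurableSet {t | 0 < H t}),
    ← measure_inter_add_sdiff {y | h y ∈ D} (measurableSet_lt measurable_const hh :
      MeasurableSet {y | 0 < h y})]
  congr 1
  · refine Eq.trans (measure_congr (Filter.eventuallyEq_set.2 ?_)) (hpos.trans (congrArg μ ?_))
    · filter_upwards [hdecomp, p0, n0] with t h1 h2 h3
      simp only [Set.mem_inter_iff, Set.mem_ofPred_eq, Set.mem_Ioi]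
      rw [hH, h1.1]
      rcases h1.2 with h0 | h0 <;> rw [h0]
      · simp [h3]
      · simp
    · ext y
      simp only [Set.mem_ofPred_eq, Set.mem_inter_iff, Set.mem_Ioi]
      rcases le_total (h y) 0 with h0 | h0
      · rw [max_eq_right h0]; grind
      · rw [max_eq_left h0]
  · refine Eq.trans (measure_congr (Filter.eventuallyEq_set.2 ?_)) (hneg.trans (congrArg μ ?_))
    · filter_upwards [hdecomp, p0, n0] with t h1 h2 h3
      simp only [Set.mem_inter_iff, Set.mem_sdiff, Set.mem_ofPred_eq, Set.mem_Ioi,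
        Set.mem_preimage]
      rw [hH, h1.1]
      rcases h1.2 with h0 | h0 <;> rw [h0]
      · rw [zero_sub]
        rcases h3.eq_or_lt with h4 | h4
        · simp [← h4, hD0]
        · simp [h4, h3]
      · rw [sub_zero]
        rcases h2.eq_or_lt with h4 | h4
        · simp [← h4, hD0]
        · simp [h4, hD0]
    · ext y
      simp only [Set.mem_ofPred_eq, Set.mem_inter_iff, Set.mem_Ioi, Set.mem_sdiff, Set.mem_preimage]
      rcases le_total (h y) 0 with h0 | h0
      · rw [max_eq_left (by linarith), neg_neg]
        rcases h0.eq_or_lt with h4 | h4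
        · simp [h4, hD0]
        · simp [h4, h0]
      · rw [max_eq_right (by linarith)]; grind

end Isometry

/-! ### The law of the nonzero values of h -/

section Law

variable {Y : Type*} [MeasurableSpace Y] {μ : Measure Y} {h : Y → ℝ}

/-- The distribution of the nonzero values of `h`. -/
noncomputable def nonzeroLaw (μ : Measure Y) (h : Y → ℝ) : Measure ℝ :=
  (μ.map h).restrict {0}ᶜ

theorem nonzeroLaw_singleton_zero : nonzeroLaw μ h {0} = 0 := by
  simp [nonzeroLaw, Measure.restrict_apply (measurableSet_singleton (0 : ℝ))]

theorem nonzeroLaw_apply (hh : Measurable h) {B : Set ℝ} (hB : MeasurableSet B) (hB0 : 0 ∉ B) :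
    nonzeroLaw μ h B = μ {y | h y ∈ B} := by
  rw [nonzeroLaw, Measure.restrict_apply hB, Set.inter_eq_left.2, Measure.map_apply hh hB]
  · rfl
  · intro x hx h0
    exact hB0 (by rwa [Set.mem_singleton_iff.1 h0] at hx)

theorem lintegral_nonzeroLaw (hh : Measurable h) {g : ℝ → ℝ≥0∞} (hg : Measurable g)
    (hg0 : g 0 = 0) : ∫⁻ x, g x ∂(nonzeroLaw μ h) = ∫⁻ y, g (h y) ∂μ := by
  rw [nonzeroLaw, ← lintegral_indicator (measurableSet_singleton _).compl, ← lintegral_map hg hh]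
  refine lintegral_congr fun x => ?_
  by_cases hx : x = 0
  · simp [hx, hg0]
  · simp [hx]

/-- By Markov's inequality, the complements of neighbourhoods of 0 have finite mass; {0} itself is
null and is added only to cover the line. -/
theorem sigmaFinite_nonzeroLaw (hh : Measurable h) (hint : ∫⁻ y, ‖h y‖ₑ ∂μ ≠ ∞) :
    SigmaFinite (nonzeroLaw μ h) := by
  have hfin : ∫⁻ x, ‖x‖ₑ ∂(nonzeroLaw μ h) ≠ ∞ := by
    rwa [lintegral_nonzeroLaw hh measurable_enorm (by simp)]
  refine ⟨⟨{ set := fun n => {x : ℝ | (n + 1 : ℝ≥0∞)⁻¹ ≤ ‖x‖ₑ} ∪ {0}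
             set_mem := fun _ => trivial
             finite := fun n => ?_
             spanning := ?_ }⟩⟩
  · refine (measure_union_le _ _).trans_lt ?_
    rw [nonzeroLaw_singleton_zero, add_zero]
    refine (meas_ge_le_lintegral_div measurable_enorm.aemeasurable ?_ ?_).trans_lt
      (ENNReal.div_lt_top hfin ?_) <;> simp
  · refine Set.eq_univ_of_forall fun x => Set.mem_iUnion.2 ?_
    by_cases hx : x = 0
    · exact ⟨0, Or.inr hx⟩
    · obtain ⟨n, hn⟩ := ENNReal.exists_inv_nat_lt (a := ‖x‖ₑ) (by simpa using hx)
      refine ⟨n, Or.inl ?_⟩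
      refine le_trans ?_ hn.le
      rw [ENNReal.inv_le_inv]
      exact le_self_add

/-- With S the supremum of the norms, Chebyshev's inequality at exponent p bounds the measure of
{|h| ≥ S + 1} by (S / (S + 1))^p, which tends to 0. -/
theorem exists_ae_abs_le_of_iSup_eLpNorm_lt_top (hmem : ∀ p : ℝ≥0, 1 ≤ p → MemLp h p μ)
    (hsup : (⨆ (p : ℝ≥0) (_ : 1 ≤ p), eLpNorm h p μ) < ∞) :
    ∃ M : ℝ, 0 ≤ M ∧ ∀ᵐ y ∂μ, |h y| ≤ M := by
  set S := ⨆ (p : ℝ≥0) (_ : 1 ≤ p), eLpNorm h p μ with hS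
  refine ⟨S.toReal + 1, by positivity, ?_⟩
  have hK : (ENNReal.ofReal (S.toReal + 1)) = S + 1 := by
    rw [ENNReal.ofReal_add ENNReal.toReal_nonneg zero_le_one, ENNReal.ofReal_toReal hsup.ne,
      ENNReal.ofReal_one]
  set E := {y | S + 1 ≤ ‖h y‖ₑ} with hE
  have hr : S / (S + 1) < 1 := by
    rw [ENNReal.div_lt_iff (Or.inl (by simp)) (Or.inl (by simp [hsup.ne])), one_mul]
    exact ENNReal.lt_add_right hsup.ne one_ne_zero
  have hbd : ∀ n : ℕ, μ E ≤ (S / (S + 1)) ^ (n + 1) := by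
    intro n
    have h1 : (1 : ℝ≥0) ≤ ((n + 1 : ℕ) : ℝ≥0) := by norm_cast; omega
    have h2 := mul_meas_ge_le_pow_eLpNorm' μ (p := (((n + 1 : ℕ) : ℝ≥0) : ℝ≥0∞)) (by simp)
      (by simp) (hmem _ h1).1 (S + 1)
    have h3 : eLpNorm h (((n + 1 : ℕ) : ℝ≥0) : ℝ≥0∞) μ ≤ S :=
      le_iSup₂ (f := fun (p : ℝ≥0) (_ : 1 ≤ p) => eLpNorm h p μ) _ h1
    have h4 : ENNReal.toReal (((n + 1 : ℕ) : ℝ≥0) : ℝ≥0∞) = ((n + 1 : ℕ) : ℝ) := rfl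
    rw [h4, ENNReal.rpow_natCast, ENNReal.rpow_natCast] at h2
    rw [div_eq_mul_inv, mul_pow, ← ENNReal.inv_pow, ← div_eq_mul_inv, ENNReal.le_div_iff_mul_le (Or.inl (by simp))
      (Or.inl (by simp [hsup.ne])), mul_comm]
    exact h2.trans (by gcongr)
  have h0 : μ E = 0 := by
    refine le_antisymm (ge_of_tendsto'
      ((ENNReal.tendsto_pow_atTop_nhds_zero_of_lt_one hr).comp (Filter.tendsto_add_atTop_nat 1))
      hbd) zero_le
  have h5 : ∀ᵐ y ∂μ, ¬ (S + 1 ≤ ‖h y‖ₑ) := by rw [ae_iff]; simpa using h0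
  filter_upwards [h5] with y hy
  rw [not_le, ← hK, ← ofReal_norm, Real.norm_eq_abs] at hy
  exact ((ENNReal.ofReal_lt_ofReal_iff_of_nonneg (abs_nonneg _)).1 hy).le

/-- From exp s - 1 ≤ s exp s, with exp s bounded because h is, the integrand is dominated by a
multiple of |h|. -/
theorem lintegral_exp_sub_one_nonzeroLaw_ne_top (hh : Measurable h) {M : ℝ}
    (hM : ∀ᵐ y ∂μ, |h y| ≤ M) (hint : ∫⁻ y, ‖h y‖ₑ ∂μ ≠ ∞) {a b : ℝ} (ha : 0 ≤ a) (hb : 0 ≤ b) :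
    ∫⁻ x, ENNReal.ofReal (Real.exp (a * max x 0 + b * max (-x) 0) - 1) ∂(nonzeroLaw μ h) ≠ ∞ := by
  rw [lintegral_nonzeroLaw hh (by fun_prop) (by simp)]
  refine ne_top_of_le_ne_top (b := ENNReal.ofReal ((a + b) * Real.exp ((a + b) * M)) *
    ∫⁻ y, ‖h y‖ₑ ∂μ) (ENNReal.mul_ne_top ENNReal.ofReal_ne_top hint) ?_
  rw [← lintegral_const_mul _ hh.enorm]
  refine lintegral_mono_ae ?_
  filter_upwards [hM] with y hy
  rw [← ofReal_norm, ← ENNReal.ofReal_mul (by positivity), Real.norm_eq_abs]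
  refine ENNReal.ofReal_le_ofReal ?_
  set s := a * max (h y) 0 + b * max (-h y) 0 with hs
  have h1 : s ≤ (a + b) * |h y| := by
    have e1 : max (h y) 0 ≤ |h y| := max_le (le_abs_self _) (abs_nonneg _)
    have e2 : max (-h y) 0 ≤ |h y| := max_le (neg_le_abs _) (abs_nonneg _)
    nlinarith [mul_le_mul_of_nonneg_left e1 ha, mul_le_mul_of_nonneg_left e2 hb]
  have h0 : 0 ≤ s := by positivity
  have h2 : Real.exp s - 1 ≤ s * Real.exp s := by
    have e1 := Real.add_one_le_exp (-s)
    have e2 : Real.exp (-s) * Real.exp s = 1 := by rw [← Real.exp_add]; simp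
    nlinarith [Real.exp_pos s]
  have h3 : Real.exp s ≤ Real.exp ((a + b) * M) := by
    refine Real.exp_le_exp.2 (h1.trans ?_)
    gcongr
  calc Real.exp s - 1 ≤ s * Real.exp s := h2
    _ ≤ ((a + b) * |h y|) * Real.exp ((a + b) * M) := by gcongr
    _ = (a + b) * Real.exp ((a + b) * M) * |h y| := by ring

end Law

end PoissonInvariance

/-! ### The law of the Skorohod integral -/

namespace PoissonInvariance

open PoissonInvariance.Configuration

section Skorohod

variable {X : Type*} [MetricSpace X] [SigmaCompactSpace X] [MeasurableSpace X] [BorelSpace X]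
  {σ : Measure X} [SigmaFinite σ] [IsFiniteMeasureOnCompacts σ] {P : Measure (Configuration X)}
  {u : Configuration X → X → ℝ} {ν : Measure ℝ}

/-- Configurations are countable and σ is diffuse, so erasing t has no effect in the compensator.
The compensator is then almost surely the constant ∫ x dν(x), because the value law is not random.
-/
theorem skorohod_ae_eq [NullSingletonClass σ] (hP : IsPoissonMeasure σ P)
    (hu : Measurable (Function.uncurry u)) (hν : HasValueLaw σ P u ν) (hν0 : ν {0} = 0)
    (hint : ∫⁻ x, ‖x‖ₑ ∂ν ≠ ∞) :
    ∀ᵐ ω ∂P, skorohod σ u ω =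
      (pointSum u (fun x => ENNReal.ofReal x) ω).toReal -
        (pointSum u (fun x => ENNReal.ofReal (-x)) ω).toReal -
      ((∫⁻ x, ENNReal.ofReal x ∂ν).toReal - (∫⁻ x, ENNReal.ofReal (-x) ∂ν).toReal) := by
  have hfin : ∀ᵐ ω ∂P, pointSum u (fun x => ‖x‖ₑ) ω < ∞ := by
    refine ae_lt_top (measurable_pointSum hu measurable_enorm) ?_
    rwa [lintegral_pointSum hP hu hν hν0 measurable_enorm (by simp)]
  filter_upwards [hfin, hν.ae_lintegral hν0 hu] with ω h1 h2
  have hm : Measurable fun t => u (ω.erase t) t :=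
    (hu.comp measurable_erase_prodMk).comp measurable_prodMk_left
  have hmω : Measurable (u ω) := hu.comp measurable_prodMk_left
  have herase : (fun t => u (ω.erase t) t) =ᵐ[σ] u ω := by
    have h0 : ∀ᵐ t ∂σ, t ∉ ω.points :=
      measure_eq_zero_iff_ae_notMem.1 ((countable_points ω).measure_zero σ)
    filter_upwards [h0] with t ht
    rw [erase_eq_self ht]
  have hi : Integrable (u ω) σ := by
    refine ⟨hmω.aestronglyMeasurable, ?_⟩
    rw [hasFiniteIntegral_iff_enorm, h2 _ measurable_enorm (by simp)]
    exact hint.lt_top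
  rw [skorohod, integral_congr_ae herase,
    integral_eq_lintegral_pos_part_sub_lintegral_neg_part (f := fun t => u (ω.erase t) t)
      ⟨hm.aestronglyMeasurable, h1⟩,
    integral_eq_lintegral_pos_part_sub_lintegral_neg_part hi,
    h2 _ ENNReal.measurable_ofReal (by simp),
    h2 (fun x => ENNReal.ofReal (-x)) (by fun_prop) (by simp)]
  rfl

theorem lintegral_exp_posPart_negPart (hP : IsPoissonMeasure σ P)
    (hu : Measurable (Function.uncurry u)) (hcyc : CyclicCondition σ P u)
    (hν : HasValueLaw σ P u ν) [SigmaFinite ν] (hν0 : ν {0} = 0)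
    (hint : ∫⁻ x, ‖x‖ₑ ∂ν ≠ ∞) {a b : ℝ} (ha : 0 ≤ a) (hb : 0 ≤ b)
    (hfin : ∫⁻ x, ENNReal.ofReal (Real.exp (a * max x 0 + b * max (-x) 0) - 1) ∂ν ≠ ∞) :
    ∫⁻ ω, ENNReal.ofReal (Real.exp (a * (pointSum u (fun x => ENNReal.ofReal x) ω).toReal +
        b * (pointSum u (fun x => ENNReal.ofReal (-x)) ω).toReal)) ∂P =
      ENNReal.ofReal (Real.exp (∫⁻ x,
        ENNReal.ofReal (Real.exp (a * max x 0 + b * max (-x) 0) - 1) ∂ν).toReal) := by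
  rw [← lintegral_exp_pointSum hP hu hcyc hν hν0 (by fun_prop) (by simp)
    (fun x => by positivity) hfin]
  have hneg : Measurable fun x : ℝ => ENNReal.ofReal (-x) := by fun_prop
  have hpfin : ∀ᵐ ω ∂P, pointSum u (fun x => ENNReal.ofReal x) ω < ∞ := by
    refine ae_lt_top (measurable_pointSum hu ENNReal.measurable_ofReal) ?_
    rw [lintegral_pointSum hP hu hν hν0 ENNReal.measurable_ofReal (by simp)]
    exact ne_top_of_le_ne_top hint (lintegral_mono fun x => Real.ofReal_le_enorm x)
  have hnfin : ∀ᵐ ω ∂P, pointSum u (fun x => ENNReal.ofReal (-x)) ω < ∞ := by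
    refine ae_lt_top (measurable_pointSum hu hneg) ?_
    rw [lintegral_pointSum hP hu hν hν0 hneg (by simp)]
    refine ne_top_of_le_ne_top hint (lintegral_mono fun x => ?_)
    exact (Real.ofReal_le_enorm (-x)).trans_eq (enorm_neg x)
  refine lintegral_congr_ae ?_
  filter_upwards [hpfin, hnfin] with ω h1 h2
  congr 2
  have hm : Measurable fun t => u (ω.erase t) t :=
    (hu.comp measurable_erase_prodMk).comp measurable_prodMk_left
  have hsplit : pointSum u (fun x => ENNReal.ofReal (a * max x 0 + b * max (-x) 0)) ω =
      ENNReal.ofReal a * pointSum u (fun x => ENNReal.ofReal x) ω +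
        ENNReal.ofReal b * pointSum u (fun x => ENNReal.ofReal (-x)) ω := by
    unfold pointSum
    have hmp : Measurable fun t => ENNReal.ofReal (u (ω.erase t) t) :=
      ENNReal.measurable_ofReal.comp hm
    have hmn : Measurable fun t => ENNReal.ofReal (-u (ω.erase t) t) := hneg.comp hm
    rw [← lintegral_const_mul _ hmp, ← lintegral_const_mul _ hmn,
      ← lintegral_add_left (hmp.const_mul _)]
    refine lintegral_congr fun t => ?_
    beta_reduce
    rw [ENNReal.ofReal_add (by positivity) (by positivity), ENNReal.ofReal_mul ha,
      ENNReal.ofReal_mul hb, ENNReal.ofReal_max, ENNReal.ofReal_max]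
    simp
  rw [hsplit, ENNReal.toReal_add (ENNReal.mul_ne_top ENNReal.ofReal_ne_top h1.ne)
    (ENNReal.mul_ne_top ENNReal.ofReal_ne_top h2.ne), ENNReal.toReal_mul, ENNReal.toReal_mul,
    ENNReal.toReal_ofReal ha, ENNReal.toReal_ofReal hb]

theorem inSkorohodDomain_of_hasValueLaw (hP : IsPoissonMeasure σ P)
    (hu : Measurable (Function.uncurry u)) (hν : HasValueLaw σ P u ν) (hν0 : ν {0} = 0)
    (hint : ∫⁻ x, ‖x‖ₑ ∂ν ≠ ∞) : InSkorohodDomain σ P u := by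
  have := hP.isProbabilityMeasure
  refine ⟨hu, ?_⟩
  have h : ∀ᵐ ω ∂P, ∫⁻ t, ‖u ω t‖ₑ ∂σ = ∫⁻ x, ‖x‖ₑ ∂ν := by
    filter_upwards [hν.ae_lintegral hν0 hu] with ω hω
    exact hω _ measurable_enorm (by simp)
  rw [lintegral_congr_ae h]
  simpa using hint.lt_top

theorem hasValueLaw_const {h : X → ℝ} (hh : Measurable h) :
    HasValueLaw σ P (fun _ => h) (nonzeroLaw σ h) :=
  Filter.Eventually.of_forall fun _ _ hB hB0 => (nonzeroLaw_apply hh hB hB0).symm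

theorem cyclicCondition_const (h : X → ℝ) : CyclicCondition σ P fun _ => h := fun m =>
  Filter.Eventually.of_forall fun q => Finset.prod_eq_zero (Finset.mem_univ 0) (by simp [diff])

/-- A configuration almost surely has no point where h and h' differ, so the sum over its points is
unaffected as well. -/
theorem skorohod_const_ae_eq [NullSingletonClass σ] (hP : IsPoissonMeasure σ P) {h h' : X → ℝ}
    (hh : h =ᵐ[σ] h') :
    skorohod σ (fun _ => h) =ᵐ[P] skorohod σ fun _ => h' := by
  filter_upwards [hP.ae_ae_toMeasure hh] with ω hω
  unfold skorohod
  rw [integral_congr_ae hω, integral_congr_ae hh]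

end Skorohod

/-- Two processes with vanishing cyclic products of differences whose values have the same law
have identically distributed Skorohod integrals. -/
theorem identDistrib_skorohod {X Y : Type*}
    [MetricSpace X] [SigmaCompactSpace X] [MeasurableSpace X] [BorelSpace X]
    [MetricSpace Y] [SigmaCompactSpace Y] [MeasurableSpace Y] [BorelSpace Y]
    {σ : Measure X} [SigmaFinite σ] [NullSingletonClass σ] [IsFiniteMeasureOnCompacts σ]
    {μ : Measure Y} [SigmaFinite μ] [NullSingletonClass μ] [IsFiniteMeasureOnCompacts μ]
    {P : Measure (Configuration X)} {Q : Measure (Configuration Y)}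
    {u : Configuration X → X → ℝ} {v : Configuration Y → Y → ℝ} {ν : Measure ℝ} [SigmaFinite ν]
    (hP : IsPoissonMeasure σ P) (hQ : IsPoissonMeasure μ Q)
    (hu : Measurable (Function.uncurry u)) (hv : Measurable (Function.uncurry v))
    (hcu : CyclicCondition σ P u) (hcv : CyclicCondition μ Q v)
    (hνu : HasValueLaw σ P u ν) (hνv : HasValueLaw μ Q v ν) (hν0 : ν {0} = 0)
    (hint : ∫⁻ x, ‖x‖ₑ ∂ν ≠ ∞)
    (hfin : ∀ a b : ℝ, 0 ≤ a → 0 ≤ b →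
      ∫⁻ x, ENNReal.ofReal (Real.exp (a * max x 0 + b * max (-x) 0) - 1) ∂ν ≠ ∞) :
    IdentDistrib (skorohod σ u) (skorohod μ v) P Q := by
  have := hP.isProbabilityMeasure
  have := hQ.isProbabilityMeasure
  have hneg : Measurable fun x : ℝ => ENNReal.ofReal (-x) := by fun_prop
  have mZ₁ := (measurable_pointSum hu ENNReal.measurable_ofReal).ennreal_toReal
  have mZ₂ := (measurable_pointSum hu hneg).ennreal_toReal
  have mW₁ := (measurable_pointSum hv ENNReal.measurable_ofReal).ennreal_toReal
  have mW₂ := (measurable_pointSum hv hneg).ennreal_toReal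
  have hmap := map_sub_eq_of_lintegral_exp_eq (μ := P) (μ' := Q) mZ₁ mZ₂ mW₁ mW₂
    (fun _ => ENNReal.toReal_nonneg) (fun _ => ENNReal.toReal_nonneg)
    (fun _ => ENNReal.toReal_nonneg) (fun _ => ENNReal.toReal_nonneg)
    (fun a b ha hb => by
      rw [lintegral_exp_posPart_negPart hP hu hcu hνu hν0 hint ha hb (hfin a b ha hb)]
      exact ENNReal.ofReal_ne_top)
    (fun a b ha hb => by
      rw [lintegral_exp_posPart_negPart hP hu hcu hνu hν0 hint ha hb (hfin a b ha hb),
        lintegral_exp_posPart_negPart hQ hv hcv hνv hν0 hint ha hb (hfin a b ha hb)])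
  have hid : IdentDistrib _ _ P Q :=
    ⟨(mZ₁.sub mZ₂).aemeasurable, (mW₁.sub mW₂).aemeasurable, hmap⟩
  have hid' := hid.sub_const
    ((∫⁻ x, ENNReal.ofReal x ∂ν).toReal - (∫⁻ x, ENNReal.ofReal (-x) ∂ν).toReal)
  have hX := IdentDistrib.of_ae_eq hid'.aemeasurable_fst
    (Filter.EventuallyEq.symm (skorohod_ae_eq hP hu hνu hν0 hint))
  have hY := IdentDistrib.of_ae_eq hid'.aemeasurable_snd
    (Filter.EventuallyEq.symm (skorohod_ae_eq hQ hv hνv hν0 hint))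
  exact (hX.symm.trans hid').trans hY

end PoissonInvariance

/-- `Rh` is a measurable process which represents `R h`, so that `D_s R h (t)` and `δ_σ(R h)` are
formed with it. -/
theorem corollary3p1 {X Y : Type*}
    [MetricSpace X] [SigmaCompactSpace X] [MeasurableSpace X] [BorelSpace X]
    [MetricSpace Y] [SigmaCompactSpace Y] [MeasurableSpace Y] [BorelSpace Y]
    (σ : Measure X) [SigmaFinite σ] [NullSingletonClass σ] [IsFiniteMeasureOnCompacts σ]
    (μ : Measure Y) [SigmaFinite μ] [NullSingletonClass μ] [IsFiniteMeasureOnCompacts μ]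
    (πσ : Measure (PoissonInvariance.Configuration X))
    (hπσ : PoissonInvariance.IsPoissonMeasure σ πσ)
    (πμ : Measure (PoissonInvariance.Configuration Y))
    (hπμ : PoissonInvariance.IsPoissonMeasure μ πμ)
    (R : PoissonInvariance.Configuration X → (Y →ₘ[μ] ℝ) → (X →ₘ[σ] ℝ))
    (hR : PoissonInvariance.IsRandomIsometry σ μ R)
    (h : Y → ℝ) (hmem : ∀ p : ℝ≥0, 1 ≤ p → MemLp h p μ)
    (hsup : (⨆ (p : ℝ≥0) (_ : 1 ≤ p), eLpNorm h p μ) < ∞)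
    (Rh : PoissonInvariance.Configuration X → X → ℝ)
    (hRh_meas : Measurable (Function.uncurry Rh))
    (hRh : ∀ᵐ ω ∂πσ, Rh ω =ᵐ[σ] R ω (AEEqFun.mk h (hmem 1 le_rfl).aestronglyMeasurable))
    (hbound : PoissonInvariance.DeltaBound σ πσ Rh)
    (hcyclic : PoissonInvariance.CyclicCondition σ πσ Rh) :
    PoissonInvariance.InSkorohodDomain σ πσ Rh ∧
      IdentDistrib (PoissonInvariance.skorohod σ Rh)
        (PoissonInvariance.skorohod μ fun _ => h) πσ πμ := by
  obtain ⟨M, -, hM⟩ :=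
    PoissonInvariance.exists_ae_abs_le_of_iSup_eLpNorm_lt_top hmem hsup
  have hae := (hmem 1 le_rfl).aestronglyMeasurable
  -- The function h is only almost everywhere measurable; g is a measurable version, replaced by h
  -- again at the end.
  set g := hae.mk h with hg
  have hgm : Measurable g := hae.stronglyMeasurable_mk.measurable
  have hhg : h =ᵐ[μ] g := hae.ae_eq_mk
  have hgmem : ∀ p : ℝ≥0, 1 ≤ p → MemLp g p μ := fun p hp => (hmem p hp).ae_eq hhg
  have hgM : ∀ᵐ y ∂μ, |g y| ≤ M := by
    filter_upwards [hM, hhg] with y h1 h2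
    rwa [← h2]
  have hgint : ∫⁻ y, ‖g y‖ₑ ∂μ ≠ ∞ := by
    have := (hgmem 1 le_rfl).2.ne
    rwa [ENNReal.coe_one, eLpNorm_one_eq_lintegral_enorm] at this
  have hmk : AEEqFun.mk h (hmem 1 le_rfl).aestronglyMeasurable =
      AEEqFun.mk g hgm.aestronglyMeasurable := AEEqFun.mk_eq_mk.2 hhg
  set ν := PoissonInvariance.nonzeroLaw μ g with hνdef
  have : SigmaFinite ν := PoissonInvariance.sigmaFinite_nonzeroLaw hgm hgint
  have hν0 : ν {0} = 0 := PoissonInvariance.nonzeroLaw_singleton_zero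
  have hint : ∫⁻ x, ‖x‖ₑ ∂ν ≠ ∞ := by
    rwa [PoissonInvariance.lintegral_nonzeroLaw hgm measurable_enorm (by simp)]
  have hνX : PoissonInvariance.HasValueLaw σ πσ Rh ν := by
    filter_upwards [hRh] with ω hω B hB hB0
    rw [PoissonInvariance.nonzeroLaw_apply hgm hB hB0,
      ← hR.measure_preimage_eq ω hgm hgmem hB hB0, ← hmk]
    refine measure_congr (Filter.eventuallyEq_set.2 ?_)
    filter_upwards [hω] with t ht
    rw [ht]
  refine ⟨PoissonInvariance.inSkorohodDomain_of_hasValueLaw hπσ hRh_meas hνX hν0 hint, ?_⟩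
  -- The deterministic process g has vanishing differences and the same value law ν, so both sides
  -- are instances of one result.
  have hid := PoissonInvariance.identDistrib_skorohod (v := fun _ => g) hπσ hπμ hRh_meas
    (hgm.comp measurable_snd) hcyclic
    (PoissonInvariance.cyclicCondition_const g) hνX
    (PoissonInvariance.hasValueLaw_const hgm) hν0 hint
    (fun a b ha hb =>
      PoissonInvariance.lintegral_exp_sub_one_nonzeroLaw_ne_top hgm hgM hgint ha hb)
  exact hid.trans (IdentDistrib.of_ae_eq hid.aemeasurable_snd
    (PoissonInvariance.skorohod_const_ae_eq hπμ hhg).symm)
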